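/- Let $n\ge 0$, let $U(n)$ be the unitary group and, for $p\ge 0$, let $N\overline{U(n)}(p)=U(n)^{p+1}\ni(g_0,\dots,g_p)$. Put $\Omega^{p,q}=\Omega^q(N\overline{U(n)}(p))$ (complex-valued forms), with $d''=(-1)^p\times$ the exterior differential on $N\overline{U(n)}(p)$, and $\Omega^m(N\overline{U(n)})=\bigoplus_{p+q=m}\Omega^{p,q}$. Let $\Delta^p$ be the standard simplex with barycentric coordinates $(t_0,\dots,t_p)$. On $\Delta^p\times U(n)^{p+1}$ consider the canonical simplicial connection $\theta=t_0\theta_0+\cdots+t_p\theta_p$, $\theta_i=g_i^{-1}dg_i$, with curvature $\Omega=d\theta+\frac12[\theta,\theta]$. Let $P$ be the symmetric bilinear form with $P(X,X)=c_2(X)$, where $\det\bigl(1-\lambda\frac{X}{2\pi i}\bigr)=\sum_k c_k(X)\lambda^k$, and set $$TP(\theta)=2\int_0^1P(\theta\wedge\phi_s)\,ds,\qquad \phi_s=s\,\Omega+\tfrac12 s(s-1)[\theta,\theta].$$ The Chern–Simons form in $\Omega^3(N\overline{U(n)})$ corresponding to $c_2$ is the family $\bigl(\int_{\Delta^p}TP(\theta)|_{\Delta^p\times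 U(n)^{p+1}}\bigr)_{0\le p\le 3}$, where $\int_{\Delta^p}$ denotes integration along $\Delta^p$ with respect to $dt_1\wedge\cdots\wedge dt_p$ (the $dt$'s written first). This form equals $Tc_{0,3}+Tc_{1,2}$ (in particular its components in $\Omega^{2,1}$ and $\Omega^{3,0}$ vanish), where $Tc_{0,3}\in\Omega^3(U(n))$ and $Tc_{1,2}\in\Omega^2(U(n)\times U(n))$ are the smooth forms $$Tc_{0,3}=\left(\frac1{2\pi i}\right)^2\frac16\,\mathrm{tr}\bigl((g^{-1}dg)^3\bigr),$$ $$Tc_{1,2}=\left(\frac1{2\pi i}\right)^2\left(\tfrac12\,\mathrm{tr}(g_0^{-1}dg_0\,g_1^{-1}dg_1)-\tfrac12\,\mathrm{tr}(g_0^{-1}dg_0)\,\mathrm{tr}(g_1^{-1}dg_1)\right),$$ and $d''Tc_{0,3}=0$. -/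

import Mathlib

open scoped Matrix.Norms.L2Operator Manifold ContDiff

/-! ## The unitary group as a manifold, via Cayley charts -/

/-- Complex `n × n` matrices (with the operator norm; a finite-dimensional real normed algebra). -/
abbrev Mat (n : ℕ) : Type := Matrix (Fin n) (Fin n) ℂ

/-- The unitary group `U(n)`, with the topology induced from the matrices. -/
abbrev UGrp (n : ℕ) : Type := Matrix.unitaryGroup (Fin n) ℂ

/-- The real vector space `𝔲(n)` of skew-Hermitian matrices: the Lie algebra of `U(n)`, on which
`U(n)` is modelled. -/
abbrev ULie (n : ℕ) : Type := skewAdjoint.submodule ℝ (Mat n)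

theorem ULie.star_eq {n : ℕ} (A : ULie n) : star (A : Mat n) = -(A : Mat n) := A.2

open scoped ComplexOrder in
theorem ULie.isUnit_one_sub {n : ℕ} (A : ULie n) : IsUnit (1 - (A : Mat n)) := by
  have h : (1 - (A : Mat n)) * (1 + (A : Mat n)) = 1 + (A : Mat n) * (A : Mat n).conjTranspose := by
    have h1 : (A : Mat n).conjTranspose = -(A : Mat n) := A.2
    rw [h1]; noncomm_ring
  have h2 : IsUnit ((1 - (A : Mat n)) * (1 + (A : Mat n))) := by
    rw [h]
    exact (Matrix.PosDef.one.add_posSemidef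
      (Matrix.posSemidef_self_mul_conjTranspose (A : Mat n))).isUnit
  rw [Matrix.isUnit_iff_isUnit_det, Matrix.det_mul] at h2
  rw [Matrix.isUnit_iff_isUnit_det]
  exact isUnit_of_mul_isUnit_left h2

theorem ULie.isUnit_one_add {n : ℕ} (A : ULie n) : IsUnit (1 + (A : Mat n)) := by
  simpa [sub_eq_add_neg] using ULie.isUnit_one_sub (-A)

theorem mul_inv_cancel_of_unit {n : ℕ} {X : Mat n} (h : IsUnit X) : X * X⁻¹ = 1 :=
  Matrix.mul_nonsing_inv X ((Matrix.isUnit_iff_isUnit_det X).1 h)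

theorem inv_mul_cancel_of_unit {n : ℕ} {X : Mat n} (h : IsUnit X) : X⁻¹ * X = 1 :=
  Matrix.nonsing_inv_mul X ((Matrix.isUnit_iff_isUnit_det X).1 h)

/-- `X ↦ (X - 1) (1 + X)⁻¹`. -/
noncomputable def cayleyMat {n : ℕ} (X : Mat n) : Mat n := (X - 1) * (1 + X)⁻¹

/-- `A ↦ (1 + A) (1 - A)⁻¹`. -/
noncomputable def cayleyInvMat {n : ℕ} (A : Mat n) : Mat n := (1 + A) * (1 - A)⁻¹

theorem star_inv_mat {n : ℕ} (X : Mat n) : star (X⁻¹) = (star X)⁻¹ :=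
  Matrix.conjTranspose_nonsing_inv X

theorem cayleyMat_mem {n : ℕ} {g : Mat n} (hg : g ∈ Matrix.unitaryGroup (Fin n) ℂ)
    (h : IsUnit (1 + g)) : cayleyMat g ∈ skewAdjoint.submodule ℝ (Mat n) := by
  change star ((g - 1) * (1 + g)⁻¹) = -((g - 1) * (1 + g)⁻¹)
  have h' : IsUnit (1 + star g) := by simpa using h.star
  have h1 : star g * g = 1 := Matrix.mem_unitaryGroup_iff'.1 hg
  have key : (star g - 1) * (1 + g) = (1 + star g) * (-(g - 1)) := by
    have e1 : (star g - 1) * (1 + g) = star g + star g * g - 1 - g := by noncomm_ring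
    have e2 : (1 + star g) * (-(g - 1)) = star g - star g * g + 1 - g := by noncomm_ring
    rw [e1, e2, h1]; abel
  rw [star_mul, star_inv_mat, star_sub, star_add, star_one]
  calc (1 + star g)⁻¹ * (star g - 1)
      = (1 + star g)⁻¹ * ((star g - 1) * (1 + g)) * (1 + g)⁻¹ := by
        rw [mul_assoc, mul_assoc, mul_inv_cancel_of_unit h, mul_one]
    _ = -((g - 1) * (1 + g)⁻¹) := by
        rw [key, ← mul_assoc, inv_mul_cancel_of_unit h', one_mul, neg_mul]

theorem cayleyInvMat_mem {n : ℕ} (A : ULie n) :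
    cayleyInvMat (A : Mat n) ∈ Matrix.unitaryGroup (Fin n) ℂ := by
  rw [Matrix.mem_unitaryGroup_iff']
  have hs : star (A : Mat n) = -(A : Mat n) := A.2
  unfold cayleyInvMat
  rw [star_mul, star_inv_mat, star_sub, star_add, star_one, hs, sub_neg_eq_add, ← sub_eq_add_neg]
  have hc : (1 - (A : Mat n)) * (1 + (A : Mat n)) = (1 + (A : Mat n)) * (1 - (A : Mat n)) := by
    noncomm_ring
  calc (1 + (A : Mat n))⁻¹ * (1 - (A : Mat n)) * ((1 + (A : Mat n)) * (1 - (A : Mat n))⁻¹)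
      = (1 + (A : Mat n))⁻¹ * ((1 - (A : Mat n)) * (1 + (A : Mat n))) * (1 - (A : Mat n))⁻¹ := by
        noncomm_ring
    _ = 1 := by
        rw [hc, ← mul_assoc, inv_mul_cancel_of_unit A.isUnit_one_add, one_mul,
          mul_inv_cancel_of_unit A.isUnit_one_sub]

theorem one_add_cayleyInvMat {n : ℕ} {A : Mat n} (h : IsUnit (1 - A)) :
    1 + cayleyInvMat A = (2 : ℂ) • (1 - A)⁻¹ := by
  unfold cayleyInvMat
  nth_rewrite 1 [← mul_inv_cancel_of_unit h]
  rw [← add_mul, show (1 - A) + (1 + A) = (2 : ℂ) • (1 : Mat n) by rw [two_smul]; abel,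
    smul_mul_assoc, one_mul]

theorem isUnit_one_add_cayleyInvMat {n : ℕ} {A : Mat n} (h : IsUnit (1 - A)) :
    IsUnit (1 + cayleyInvMat A) := by
  rw [one_add_cayleyInvMat h]
  have h3 : IsUnit ((1 - A)⁻¹) := by
    rwa [Matrix.isUnit_nonsing_inv_iff]
  exact h3.smul (Units.mk0 (2 : ℂ) two_ne_zero)

theorem cayleyMat_cayleyInvMat {n : ℕ} {A : Mat n} (h : IsUnit (1 - A)) :
    cayleyMat (cayleyInvMat A) = A := by
  have hu := isUnit_one_add_cayleyInvMat h
  have h1 : cayleyInvMat A - 1 = A * (1 + cayleyInvMat A) := by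
    rw [one_add_cayleyInvMat h]
    calc cayleyInvMat A - 1 = (1 + A) * (1 - A)⁻¹ - (1 - A) * (1 - A)⁻¹ := by
          rw [mul_inv_cancel_of_unit h]; rfl
      _ = A * (2 : ℂ) • (1 - A)⁻¹ := ?_
    rw [← sub_mul, show (1 + A) - (1 - A) = (2 : ℂ) • A by rw [two_smul]; abel,
      smul_mul_assoc, mul_smul_comm]
  unfold cayleyMat
  rw [h1, mul_assoc, mul_inv_cancel_of_unit hu, mul_one]

theorem one_sub_cayleyMat {n : ℕ} {g : Mat n} (h : IsUnit (1 + g)) :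
    1 - cayleyMat g = (2 : ℂ) • (1 + g)⁻¹ := by
  unfold cayleyMat
  nth_rewrite 1 [← mul_inv_cancel_of_unit h]
  rw [← sub_mul, show (1 + g) - (g - 1) = (2 : ℂ) • (1 : Mat n) by rw [two_smul]; abel,
    smul_mul_assoc, one_mul]

theorem cayleyInvMat_cayleyMat {n : ℕ} {g : Mat n} (h : IsUnit (1 + g)) :
    cayleyInvMat (cayleyMat g) = g := by
  have hu : IsUnit (1 - cayleyMat g) := by
    rw [one_sub_cayleyMat h]
    have h3 : IsUnit ((1 + g)⁻¹) := by rwa [Matrix.isUnit_nonsing_inv_iff]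
    exact h3.smul (Units.mk0 (2 : ℂ) two_ne_zero)
  have h1 : 1 + cayleyMat g = g * (1 - cayleyMat g) := by
    rw [one_sub_cayleyMat h]
    unfold cayleyMat
    nth_rewrite 1 [← mul_inv_cancel_of_unit h]
    rw [← add_mul, show (1 + g) + (g - 1) = (2 : ℂ) • g by rw [two_smul]; abel,
      smul_mul_assoc, mul_smul_comm]
  unfold cayleyInvMat
  rw [h1, mul_assoc, mul_inv_cancel_of_unit hu, mul_one]

theorem contDiffAt_inv_mat {n : ℕ} {k : ℕ∞ω} {X : Mat n} (h : IsUnit X) :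
    ContDiffAt ℝ k (fun Y : Mat n => Y⁻¹) X := by
  have : (fun Y : Mat n => Y⁻¹) = Ring.inverse := by
    funext Y; exact Matrix.nonsing_inv_eq_ringInverse Y
  rw [this]
  obtain ⟨u, rfl⟩ := h
  exact contDiffAt_ringInverse ℝ u

theorem contDiffAt_cayleyMat {n : ℕ} {k : ℕ∞ω} {X : Mat n} (h : IsUnit (1 + X)) :
    ContDiffAt ℝ k (cayleyMat : Mat n → Mat n) X := by
  have h1 : ContDiffAt ℝ k (fun Y : Mat n => 1 + Y) X := by fun_prop
  have h2 : ContDiffAt ℝ k (fun Y : Mat n => (1 + Y)⁻¹) X :=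
    (contDiffAt_inv_mat h).comp X h1
  exact (contDiffAt_id.sub contDiffAt_const).mul h2

theorem contDiffAt_cayleyInvMat {n : ℕ} {k : ℕ∞ω} {X : Mat n} (h : IsUnit (1 - X)) :
    ContDiffAt ℝ k (cayleyInvMat : Mat n → Mat n) X := by
  have h1 : ContDiffAt ℝ k (fun Y : Mat n => 1 - Y) X := by fun_prop
  have h2 : ContDiffAt ℝ k (fun Y : Mat n => (1 - Y)⁻¹) X :=
    (contDiffAt_inv_mat h).comp X h1
  exact (contDiffAt_const.add contDiffAt_id).mul h2

/-- The Cayley chart of `U(n)` around the identity: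
`g ↦ (g - 1) (1 + g)⁻¹`, from `{g | 1 + g invertible}` onto `𝔲(n)`. -/
noncomputable def cayleyChart (n : ℕ) : OpenPartialHomeomorph (UGrp n) (ULie n) where
  toFun g := by
    classical
    exact if h : IsUnit (1 + (g : Mat n)) then ⟨cayleyMat g, cayleyMat_mem g.2 h⟩ else 0
  invFun A := ⟨cayleyInvMat (A : Mat n), cayleyInvMat_mem A⟩
  source := {g | IsUnit (1 + (g : Mat n))}
  target := Set.univ
  map_source' _ _ := Set.mem_univ _
  map_target' A _ := isUnit_one_add_cayleyInvMat A.isUnit_one_sub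
  left_inv' g hg := by
    have hg' : IsUnit (1 + (g : Mat n)) := hg
    apply Subtype.ext
    simp [hg', cayleyInvMat_cayleyMat hg']
  right_inv' A _ := by
    have h := isUnit_one_add_cayleyInvMat A.isUnit_one_sub
    apply Subtype.ext
    simp [h, cayleyMat_cayleyInvMat A.isUnit_one_sub]
  open_source := by
    have : {g : UGrp n | IsUnit (1 + (g : Mat n))} =
        (fun g : UGrp n => 1 + (g : Mat n)) ⁻¹' {X | IsUnit X} := rfl
    rw [this]
    exact Units.isOpen.preimage (continuous_const.add continuous_subtype_val)
  open_target := isOpen_univ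
  continuousOn_toFun := by
    rw [Topology.IsInducing.subtypeVal.continuousOn_iff]
    have : ContinuousOn (fun g : UGrp n => cayleyMat (g : Mat n))
        {g | IsUnit (1 + (g : Mat n))} := fun g hg =>
      ((contDiffAt_cayleyMat (k := 0) hg).continuousAt.comp
        continuous_subtype_val.continuousAt).continuousWithinAt
    refine this.congr fun g hg => ?_
    have hg' : IsUnit (1 + (g : Mat n)) := hg
    simp [hg']
  continuousOn_invFun := by
    rw [Topology.IsInducing.subtypeVal.continuousOn_iff]
    exact fun A _ => ((contDiffAt_cayleyInvMat (k := 0) A.isUnit_one_sub).continuousAt.comp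
        continuous_subtype_val.continuousAt).continuousWithinAt

/-- The left translate of the Cayley chart, centred at `g₀`. -/
noncomputable def cayleyChartAt {n : ℕ} (g₀ : UGrp n) : OpenPartialHomeomorph (UGrp n) (ULie n) :=
  (Homeomorph.mulLeft g₀⁻¹).toOpenPartialHomeomorph.trans (cayleyChart n)

noncomputable instance instChartedSpaceUGrp (n : ℕ) : ChartedSpace (ULie n) (UGrp n) where
  atlas := Set.range cayleyChartAt
  chartAt := cayleyChartAt
  mem_chart_source g := by
    have : IsUnit (1 + (1 : Mat n)) := by
      rw [show (1 : Mat n) + 1 = (2 : ℂ) • 1 by rw [two_smul]]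
      exact isUnit_one.smul (Units.mk0 (2 : ℂ) two_ne_zero)
    simpa [cayleyChartAt, cayleyChart] using this
  chart_mem_atlas g := Set.mem_range_self g

theorem cayleyChart_apply {n : ℕ} {g : UGrp n} (h : IsUnit (1 + (g : Mat n))) :
    cayleyChart n g = ⟨cayleyMat g, cayleyMat_mem g.2 h⟩ := dif_pos h

theorem cayleyChartAt_symm_apply {n : ℕ} (g : UGrp n) (A : ULie n) :
    (cayleyChartAt g).symm A = g * ⟨cayleyInvMat (A : Mat n), cayleyInvMat_mem A⟩ := by
  change (g⁻¹)⁻¹ * (⟨cayleyInvMat (A : Mat n), cayleyInvMat_mem A⟩ : UGrp n) = _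
  rw [inv_inv]

theorem mem_cayleyChartAt_source {n : ℕ} {g x : UGrp n} :
    x ∈ (cayleyChartAt g).source ↔ IsUnit (1 + ((g⁻¹ * x : UGrp n) : Mat n)) := by
  simp only [cayleyChartAt, OpenPartialHomeomorph.trans_source]
  exact ⟨fun h => h.2, fun h => ⟨Set.mem_univ _, h⟩⟩

theorem contDiffOn_cayley_transition {n : ℕ} (k : ℕ∞ω) (g h : UGrp n) :
    ContDiffOn ℝ k ((cayleyChartAt g).symm.trans (cayleyChartAt h))
      ((cayleyChartAt g).symm.trans (cayleyChartAt h)).source := by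
  intro A hA
  have hsrc : ∀ B ∈ ((cayleyChartAt g).symm.trans (cayleyChartAt h)).source,
      IsUnit (1 + (((h⁻¹ * (g * ⟨cayleyInvMat (B : Mat n), cayleyInvMat_mem B⟩) : UGrp n)) :
        Mat n)) := by
    intro B hB
    have hB2 : (cayleyChartAt g).symm B ∈ (cayleyChartAt h).source := hB.2
    rwa [mem_cayleyChartAt_source, cayleyChartAt_symm_apply] at hB2
  let P : Mat n →L[ℝ] ULie n := LinearMap.toContinuousLinearMap
    (skewAdjointPart ℝ : Mat n →ₗ[ℝ] skewAdjoint.submodule ℝ (Mat n))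
  have hval : ∀ B ∈ ((cayleyChartAt g).symm.trans (cayleyChartAt h)).source,
      ((cayleyChartAt g).symm.trans (cayleyChartAt h)) B =
        P (cayleyMat ((h⁻¹ : UGrp n) * ((g : Mat n) * cayleyInvMat (B : Mat n)))) := by
    intro B hB
    have hu := hsrc B hB
    have e1 : ((cayleyChartAt g).symm.trans (cayleyChartAt h)) B =
        cayleyChart n (h⁻¹ * (g * ⟨cayleyInvMat (B : Mat n), cayleyInvMat_mem B⟩)) := by
      rw [← cayleyChartAt_symm_apply]; rfl
    rw [e1, cayleyChart_apply hu]
    exact (LinearMap.congr_fun (skewAdjointPart_comp_subtype_skewAdjoint (R := ℝ) (A := Mat n))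
      ⟨_, cayleyMat_mem (Subtype.prop _) hu⟩).symm
  have hcd : ContDiffAt ℝ k (fun B : ULie n =>
      P (cayleyMat ((h⁻¹ : UGrp n) * ((g : Mat n) * cayleyInvMat (B : Mat n))))) A := by
    refine P.contDiff.contDiffAt.comp A ?_
    have c1 : ContDiffAt ℝ k (fun B : ULie n => cayleyInvMat (B : Mat n)) A :=
      (contDiffAt_cayleyInvMat A.isUnit_one_sub).comp A
        (Submodule.subtypeL (skewAdjoint.submodule ℝ (Mat n))).contDiff.contDiffAt
    have c2 : ContDiffAt ℝ k (fun B : ULie n =>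
        ((h⁻¹ : UGrp n) : Mat n) * ((g : Mat n) * cayleyInvMat (B : Mat n))) A :=
      contDiffAt_const.mul (contDiffAt_const.mul c1)
    exact ContDiffAt.comp A (contDiffAt_cayleyMat (hsrc A hA)) c2
  exact hcd.contDiffWithinAt.congr hval (hval A hA)

instance instIsManifoldUGrp (n : ℕ) (k : ℕ∞ω) : IsManifold 𝓘(ℝ, ULie n) k (UGrp n) := by
  apply isManifold_of_contDiffOn
  rintro _ _ ⟨g, rfl⟩ ⟨h, rfl⟩
  simpa using contDiffOn_cayley_transition k g h

/-! ## Finite products of `U(n)` -/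

/-- `U(n)^(p+1)`: the `p`-th manifold `N\overline{U(n)}(p)` of the simplicial manifold. -/
abbrev NBar (n p : ℕ) : Type := Fin (p + 1) → UGrp n

/-- The model space `𝔲(n)^(p+1)` of `U(n)^(p+1)`. -/
abbrev NBarLie (n p : ℕ) : Type := Fin (p + 1) → ULie n

/-- `U(n)^(p+1)` carries the product of the atlases of the factors. -/
noncomputable instance instChartedSpaceNBar (n p : ℕ) : ChartedSpace (NBarLie n p) (NBar n p) :=
  piChartedSpace (fun _ : Fin (p + 1) => ULie n) (fun _ : Fin (p + 1) => UGrp n)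

instance instIsManifoldNBar (n p : ℕ) (k : ℕ∞ω) :
    IsManifold 𝓘(ℝ, NBarLie n p) k (NBar n p) := by
  apply isManifold_of_contDiffOn
  rintro _ _ ⟨e, he, rfl⟩ ⟨f, hf, rfl⟩
  have he' : ∀ i, ∃ g, cayleyChartAt g = e i := fun i => he i (Set.mem_univ i)
  have hf' : ∀ i, ∃ g, cayleyChartAt g = f i := fun i => hf i (Set.mem_univ i)
  rw [contDiffOn_pi]
  intro i
  obtain ⟨g, hg⟩ := he' i
  obtain ⟨h, hh⟩ := hf' i
  have key := contDiffOn_cayley_transition k g h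
  rw [hg, hh] at key
  refine ContDiffOn.comp (g := (e i).symm.trans (f i)) (f := fun A : NBarLie n p => A i) key
    (contDiff_apply ℝ (ULie n) i).contDiffOn ?_
  rintro A ⟨⟨hA1, hA2⟩, -⟩
  exact ⟨hA1 i (Set.mem_univ i), hA2 i (Set.mem_univ i)⟩

/-! ## Differential forms on manifolds -/

theorem update_castAdd_castAdd {E : Type*} {k l : ℕ} (v : Fin (k + l) → E) (a : Fin k) (z : E) :
    (fun i => Function.update v (Fin.castAdd l a) z (Fin.castAdd l i)) =
      Function.update (fun i => v (Fin.castAdd l i)) a z := by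
  funext i
  by_cases h : i = a
  · subst h; simp
  · rw [Function.update_of_ne h, Function.update_of_ne (by simpa using h)]

theorem update_castAdd_natAdd {E : Type*} {k l : ℕ} (v : Fin (k + l) → E) (a : Fin k) (z : E) :
    (fun j => Function.update v (Fin.castAdd l a) z (Fin.natAdd k j)) =
      fun j => v (Fin.natAdd k j) := by
  funext j
  exact Function.update_of_ne (by simp [Fin.ext_iff]; omega) _ _

theorem update_natAdd_natAdd {E : Type*} {k l : ℕ} (v : Fin (k + l) → E) (b : Fin l) (z : E) :
    (fun j => Function.update v (Fin.natAdd k b) z (Fin.natAdd k j)) =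
      Function.update (fun j => v (Fin.natAdd k j)) b z := by
  funext j
  by_cases h : j = b
  · subst h; simp
  · rw [Function.update_of_ne h, Function.update_of_ne (by simpa using h)]

theorem update_natAdd_castAdd {E : Type*} {k l : ℕ} (v : Fin (k + l) → E) (b : Fin l) (z : E) :
    (fun i => Function.update v (Fin.natAdd k b) z (Fin.castAdd l i)) =
      fun i => v (Fin.castAdd l i) := by
  funext i
  exact Function.update_of_ne (by simp [Fin.ext_iff]; omega) _ _

/-- The tuple `(w₁, …, w_p, v₁, …, v_{m-p})`. -/
def insertTuple {E : Type*} {p m : ℕ} (w : Fin p → E) (v : Fin (m - p) → E) : Fin m → E := fun i =>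
  if h : i.1 < p then w ⟨i.1, h⟩ else v ⟨i.1 - p, by omega⟩

theorem insertTuple_update {E : Type*} {p m : ℕ} (w : Fin p → E) (v : Fin (m - p) → E) (j : Fin (m - p))
    (z : E) : insertTuple w (Function.update v j z) =
      Function.update (insertTuple w v) ⟨j.1 + p, by omega⟩ z := by
  funext i
  by_cases hi : i = ⟨j.1 + p, by omega⟩
  · rw [hi]; simp [insertTuple]
  · rw [Function.update_of_ne hi]
    by_cases h : i.1 < p
    · simp [insertTuple, h]
    · have h3 : (⟨i.1 - p, by omega⟩ : Fin (m - p)) ≠ j := by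
        intro h4
        have := congrArg Fin.val h4
        exact hi (Fin.ext (by simp at this ⊢; omega))
      simp [insertTuple, h, Function.update_of_ne h3]

section Forms

variable {E E' F F' F'' H H' M M' : Type*}
  [NormedAddCommGroup E] [NormedSpace ℝ E] [NormedAddCommGroup E'] [NormedSpace ℝ E']
  [NormedAddCommGroup F] [NormedSpace ℝ F] [NormedAddCommGroup F'] [NormedSpace ℝ F']
  [NormedAddCommGroup F''] [NormedSpace ℝ F'']
  [TopologicalSpace H] [TopologicalSpace H']
  [TopologicalSpace M] [ChartedSpace H M] [TopologicalSpace M'] [ChartedSpace H' M']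

/-- `F`-valued differential `k`-forms (no regularity imposed) on a manifold `M` modelled on `E`;
the tangent space of `M` at `x` is `TangentSpace I x`, which is `E` by definition. -/
abbrev DForm (M E F : Type*) [NormedAddCommGroup E] [NormedSpace ℝ E] [NormedAddCommGroup F]
    [NormedSpace ℝ F] (k : ℕ) : Type _ := M → E [⋀^Fin k]→L[ℝ] F

/-- The pullback `f^* η` of a form along `f : M → M'`. -/
noncomputable def DForm.pullback (I : ModelWithCorners ℝ E H) (I' : ModelWithCorners ℝ E' H')
    (f : M → M') {k : ℕ} (η : DForm M' E' F k) : DForm M E F k := fun x =>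
  (η (f x)).compContinuousLinearMap (mfderiv I I' f x : E →L[ℝ] E')

/-- The expression of a form in the chart around `x₀`: its pullback along the inverse chart. -/
noncomputable def DForm.inChart (I : ModelWithCorners ℝ E H) {k : ℕ} (η : DForm M E F k)
    (x₀ : M) : E → E [⋀^Fin k]→L[ℝ] F := fun y =>
  (η ((extChartAt I x₀).symm y)).compContinuousLinearMap
    (mfderivWithin 𝓘(ℝ, E) I (extChartAt I x₀).symm (Set.range I) y : E →L[ℝ] E)

/-- A form is smooth if it is smooth in every chart of the atlas at the points of `M`. -/
def DForm.IsSmooth (I : ModelWithCorners ℝ E H) {k : ℕ} (η : DForm M E F k) : Prop :=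
  ∀ x₀ : M, ContDiffOn ℝ ∞ (η.inChart I x₀) (extChartAt I x₀).target

/-- The exterior derivative, within a subset `s` of `M`: computed in the chart around the point,
and transported back to the manifold. -/
noncomputable def DForm.extDWithin (I : ModelWithCorners ℝ E H) {k : ℕ} (η : DForm M E F k)
    (s : Set M) : DForm M E F (k + 1) := fun x =>
  (extDerivWithin (η.inChart I x) ((extChartAt I x).symm ⁻¹' s ∩ Set.range I)
    (extChartAt I x x)).compContinuousLinearMap
      (mfderiv I 𝓘(ℝ, E) (extChartAt I x) x : E →L[ℝ] E)

/-- The exterior derivative `dη`. -/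
noncomputable def DForm.extD (I : ModelWithCorners ℝ E H) {k : ℕ} (η : DForm M E F k) :
    DForm M E F (k + 1) := η.extDWithin I Set.univ

/-- `(v₁, …, v_{k+l}) ↦ B (α(v₁, …, v_k), β(v_{k+1}, …, v_{k+l}))`. -/
noncomputable def altTensor (B : F →L[ℝ] F' →L[ℝ] F'') {k l : ℕ} (α : E [⋀^Fin k]→L[ℝ] F)
    (β : E [⋀^Fin l]→L[ℝ] F') : ContinuousMultilinearMap ℝ (fun _ : Fin (k + l) => E) F'' where
  toFun v := B (α fun i => v (Fin.castAdd l i)) (β fun j => v (Fin.natAdd k j))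
  map_update_add' {dec} v i x y := by
    rw [Subsingleton.elim dec (instDecidableEqFin (k + l))]
    induction i using Fin.addCases with
    | left a =>
      rw [update_castAdd_castAdd, update_castAdd_natAdd, update_castAdd_castAdd,
        update_castAdd_natAdd, update_castAdd_castAdd, update_castAdd_natAdd,
        α.map_update_add, map_add]
      rfl
    | right b =>
      rw [update_natAdd_natAdd, update_natAdd_castAdd, update_natAdd_natAdd,
        update_natAdd_castAdd, update_natAdd_natAdd, update_natAdd_castAdd,
        β.map_update_add, map_add]
  map_update_smul' {dec} v i c x := by
    rw [Subsingleton.elim dec (instDecidableEqFin (k + l))]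
    induction i using Fin.addCases with
    | left a =>
      rw [update_castAdd_castAdd, update_castAdd_natAdd, update_castAdd_castAdd,
        update_castAdd_natAdd, α.map_update_smul, map_smul]
      rfl
    | right b =>
      rw [update_natAdd_natAdd, update_natAdd_castAdd, update_natAdd_natAdd,
        update_natAdd_castAdd, β.map_update_smul, map_smul]
  cont := by
    have h1 : Continuous fun v : Fin (k + l) → E => B (α fun i => v (Fin.castAdd l i)) :=
      B.continuous.comp (α.cont.comp (by fun_prop))
    have h2 : Continuous fun v : Fin (k + l) → E => β fun j => v (Fin.natAdd k j) :=
      β.cont.comp (by fun_prop)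
    exact h1.clm_apply h2

/-- The wedge product of vector-valued alternating forms with respect to a bilinear map `B`:
`(α ∧ β)(v) = 1/(k! l!) ∑_σ sgn(σ) B (α(v_{σ 1}, …, v_{σ k}), β(v_{σ (k+1)}, …, v_{σ (k+l)}))`.
In particular `(α ∧ β)(v, w) = B (α v, β w) - B (α w, β v)` for one-forms. -/
noncomputable def altWedge (B : F →L[ℝ] F' →L[ℝ] F'') {k l : ℕ} (α : E [⋀^Fin k]→L[ℝ] F)
    (β : E [⋀^Fin l]→L[ℝ] F') : E [⋀^Fin (k + l)]→L[ℝ] F'' :=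
  ((Nat.factorial k * Nat.factorial l : ℝ)⁻¹) • ContinuousMultilinearMap.alternatization (altTensor B α β)

/-- The wedge product of differential forms with respect to a bilinear map. -/
noncomputable def DForm.wedge (B : F →L[ℝ] F' →L[ℝ] F'') {k l : ℕ} (α : DForm M E F k)
    (β : DForm M E F' l) : DForm M E F'' (k + l) := fun x => altWedge B (α x) (β x)

/-- Apply a linear map to the values of a form. -/
noncomputable def DForm.mapVal (L : F →L[ℝ] F') {k : ℕ} (α : DForm M E F k) : DForm M E F' k :=
  fun x => L.compContinuousAlternatingMap (α x)

/-- Insert fixed vectors `w₁, …, w_p` into the first `p` slots of an alternating `m`-form. -/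
noncomputable def altInsert {p m : ℕ} (α : E [⋀^Fin m]→L[ℝ] F) (w : Fin p → E) :
    E [⋀^Fin (m - p)]→L[ℝ] F where
  toFun v := α (insertTuple w v)
  map_update_add' {dec} v j x y := by
    rw [Subsingleton.elim dec (instDecidableEqFin (m - p))]
    rw [insertTuple_update, insertTuple_update, insertTuple_update, α.map_update_add]
  map_update_smul' {dec} v j c x := by
    rw [Subsingleton.elim dec (instDecidableEqFin (m - p))]
    rw [insertTuple_update, insertTuple_update, α.map_update_smul]
  cont := by
    refine α.cont.comp (continuous_pi fun i => ?_)
    by_cases h : i.1 < p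
    · simp only [insertTuple, h, dite_true]; exact continuous_const
    · simp only [insertTuple, h, dite_false]; exact continuous_apply _
  map_eq_zero_of_eq' v i j hij hne := by
    refine α.map_eq_zero_of_eq _ (i := ⟨i.1 + p, by omega⟩) (j := ⟨j.1 + p, by omega⟩) ?_ ?_
    · simpa [insertTuple] using hij
    · simpa [Fin.ext_iff] using hne

end Forms

/-! ## The second Chern polynomial -/

/-- The `k`-th Chern polynomial on matrices, `det (1 - λ X / (2πi)) = ∑ k, c_k(X) λ^k`. -/
noncomputable def chernPoly {n : ℕ} (k : ℕ) (X : Mat n) : ℂ :=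
  (1 + (Polynomial.X : Polynomial ℂ) •
    ((-(1 / (2 * Real.pi * Complex.I))) • X).map Polynomial.C).det.coeff k

theorem coeff_two_det_one_add {n : ℕ} (A : Mat n) :
    (1 + (Polynomial.X : Polynomial ℂ) • A.map Polynomial.C).det.coeff 2 =
      (A.trace ^ 2 - (A * A).trace) / 2 := by
  have hz : ∀ M : Mat n, (1 + (Polynomial.X : Polynomial ℂ) • M.map Polynomial.C).det.coeff 0 = 1 :=
    fun M => by rw [Matrix.det_one_add_X_smul]; simp [Polynomial.coeff_X, pow_two]
  set f := (1 + (Polynomial.X : Polynomial ℂ) • A.map Polynomial.C).det with hf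
  have h1 : f.comp (-Polynomial.X) =
      (1 - (Polynomial.X : Polynomial ℂ) • A.map Polynomial.C).det := by
    rw [← Polynomial.coe_compRingHom_apply, hf, RingHom.map_det]
    congr 1
    ext i j : 1
    by_cases hij : i = j <;> simp [hij, sub_eq_add_neg]
  have h2 : (Polynomial.expand ℂ 2)
      (1 + (Polynomial.X : Polynomial ℂ) • (-(A * A)).map Polynomial.C).det =
      (1 - (Polynomial.X ^ 2 : Polynomial ℂ) • (A.map Polynomial.C * A.map Polynomial.C)).det := by
    rw [AlgHom.map_det]
    congr 1
    have hm : (A * A).map (Polynomial.C : ℂ →+* Polynomial ℂ) =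
        A.map Polynomial.C * A.map Polynomial.C := Matrix.map_mul
    rw [← hm]
    ext i j : 1
    simp only [AlgHom.mapMatrix_apply, Matrix.map_apply, Matrix.add_apply, Matrix.sub_apply,
      Matrix.smul_apply, Matrix.neg_apply, smul_eq_mul, map_add, map_mul, map_neg,
      Polynomial.expand_X, Polynomial.expand_C]
    by_cases hij : i = j
    · subst hij; rw [Matrix.one_apply_eq, map_one]; ring
    · rw [Matrix.one_apply_ne hij, map_zero]; ring
  have h3 : f * f.comp (-Polynomial.X) = (Polynomial.expand ℂ 2)
      (1 + (Polynomial.X : Polynomial ℂ) • (-(A * A)).map Polynomial.C).det := by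
    rw [h1, h2, hf, ← Matrix.det_mul]
    congr 1
    rw [mul_sub, mul_one, add_mul (1 : Matrix (Fin n) (Fin n) (Polynomial ℂ)), one_mul,
      smul_mul_smul_comm, pow_two]
    abel
  have h4 := congrArg (fun q : Polynomial ℂ => q.coeff 2) h3
  have h5 : ((Polynomial.expand ℂ 2)
      (1 + (Polynomial.X : Polynomial ℂ) • (-(A * A)).map Polynomial.C).det).coeff 2 =
      -(A * A).trace := by
    have := Polynomial.coeff_expand_mul (p := 2) (by norm_num)
      (1 + (Polynomial.X : Polynomial ℂ) • (-(A * A)).map Polynomial.C).det 1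
    rw [one_mul] at this
    rw [this, Matrix.coeff_det_one_add_X_smul_one, Matrix.trace_neg]
  simp only [h5, Polynomial.coeff_mul, Finset.Nat.sum_antidiagonal_eq_sum_range_succ_mk,
    Finset.sum_range_succ, Finset.sum_range_zero] at h4
  have hc : ∀ k, (f.comp (-Polynomial.X)).coeff k = (-1) ^ k * f.coeff k := fun k => by
    rw [show (-Polynomial.X : Polynomial ℂ) = Polynomial.C (-1) * Polynomial.X by simp,
      Polynomial.comp_C_mul_X_coeff, mul_comm]
  have h6 : f.coeff 0 = 1 := hz A
  have h7 : f.coeff 1 = A.trace := Matrix.coeff_det_one_add_X_smul_one A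
  simp [h6, h7, hc] at h4
  linear_combination h4 / 2

theorem chernPoly_two {n : ℕ} (X : Mat n) :
    chernPoly 2 X =
      (1 / (2 * Real.pi * Complex.I)) ^ 2 * ((X.trace ^ 2 - (X * X).trace) / 2) := by
  rw [chernPoly, coeff_two_det_one_add]
  simp only [Matrix.trace_smul, smul_mul_assoc, mul_smul_comm, smul_eq_mul]
  ring

/-- The polarization of `c_2`: the symmetric bilinear form `P` with `P(X, X) = c_2(X)`. -/
noncomputable def chernTwoPol (n : ℕ) : Mat n →L[ℝ] Mat n →L[ℝ] ℂ :=
  LinearMap.toContinuousBilinearMap <|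
    LinearMap.mk₂ ℝ
      (fun X Y => (chernPoly 2 (X + Y) - chernPoly 2 X - chernPoly 2 Y) / 2)
      (fun X X' Y => by
        simp only [chernPoly_two, Matrix.trace_add, add_mul, mul_add]
        rw [Matrix.trace_mul_comm X' X, Matrix.trace_mul_comm Y X, Matrix.trace_mul_comm Y X']
        ring)
      (fun c X Y => by
        simp only [chernPoly_two, Matrix.trace_add, add_mul, mul_add, smul_mul_assoc,
          mul_smul_comm, Matrix.trace_smul, Complex.real_smul]
        rw [Matrix.trace_mul_comm Y X]
        ring)
      (fun X Y Y' => by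
        simp only [chernPoly_two, Matrix.trace_add, add_mul, mul_add]
        rw [Matrix.trace_mul_comm Y' Y, Matrix.trace_mul_comm Y X, Matrix.trace_mul_comm Y' X]
        ring)
      (fun c X Y => by
        simp only [chernPoly_two, Matrix.trace_add, add_mul, mul_add, smul_mul_assoc,
          mul_smul_comm, Matrix.trace_smul, Complex.real_smul]
        rw [Matrix.trace_mul_comm Y X]
        ring)

theorem chernTwoPol_apply {n : ℕ} (X Y : Mat n) :
    chernTwoPol n X Y = (chernPoly 2 (X + Y) - chernPoly 2 X - chernPoly 2 Y) / 2 := rfl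

theorem chernTwoPol_self {n : ℕ} (X : Mat n) : chernTwoPol n X X = chernPoly 2 X := by
  rw [chernTwoPol_apply]
  simp only [chernPoly_two, Matrix.trace_add, add_mul, mul_add]
  ring

/-! ## The canonical connection on the simplicial bundle and its Chern–Simons form -/

/-- The Maurer–Cartan form `g⁻¹ dg` of `U(n)`, as a matrix-valued one-form; here `dg` is the
differential of the inclusion of `U(n)` into the matrices. -/
noncomputable def maurerCartan (n : ℕ) : DForm (UGrp n) (ULie n) (Mat n) 1 := fun g =>
  ContinuousAlternatingMap.ofSubsingleton ℝ (ULie n) (Mat n) (0 : Fin 1)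
    ((ContinuousLinearMap.mul ℝ (Mat n) ((g⁻¹ : UGrp n) : Mat n)).comp
      (mvfderiv 𝓘(ℝ, ULie n) (fun h : UGrp n => (h : Mat n)) g : ULie n →L[ℝ] Mat n))

/-- The standard simplex `Δ^p = {(t₀, …, t_p) | t_i ≥ 0, ∑ t_i = 1}`, described by the
coordinates `(t₁, …, t_p)`. -/
def simplex (p : ℕ) : Set (Fin p → ℝ) := {t | (∀ i, 0 ≤ t i) ∧ ∑ i, t i ≤ 1}

/-- The barycentric coordinates `(t₀, …, t_p)`, where `t₀ = 1 - t₁ - ⋯ - t_p`. -/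
def barycentric {p : ℕ} (t : Fin p → ℝ) : Fin (p + 1) → ℝ := Fin.cons (1 - ∑ i, t i) t

/-- The model with corners of `Δ^p × U(n)^(p+1)`; the simplex is regarded as a subset of its
affine hull, with coordinates `(t₁, …, t_p) ∈ ℝ^p`. -/
noncomputable abbrev simpModel (n p : ℕ) :
    ModelWithCorners ℝ ((Fin p → ℝ) × NBarLie n p) (ModelProd (Fin p → ℝ) (NBarLie n p)) :=
  𝓘(ℝ, Fin p → ℝ).prod 𝓘(ℝ, NBarLie n p)

/-- Sequences `(α^(p))_p` of `k`-forms on `Δ^p × U(n)^(p+1)`. Only the values at points of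
`Δ^p × U(n)^(p+1)` are ever used. -/
abbrev SimpForm (n : ℕ) (F : Type*) [NormedAddCommGroup F] [NormedSpace ℝ F] (k : ℕ) : Type _ :=
  ∀ p : ℕ, DForm ((Fin p → ℝ) × NBar n p) ((Fin p → ℝ) × NBarLie n p) F k

/-- The exterior derivative on each `Δ^p × U(n)^(p+1)`. -/
noncomputable def SimpForm.d {n : ℕ} {F : Type*} [NormedAddCommGroup F] [NormedSpace ℝ F] {k : ℕ}
    (α : SimpForm n F k) : SimpForm n F (k + 1) := fun p =>
  (α p).extDWithin (simpModel n p) (simplex p ×ˢ Set.univ)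

/-- The wedge product, with respect to a bilinear map, on each `Δ^p × U(n)^(p+1)`. -/
noncomputable def SimpForm.wedge {n : ℕ} {F F' F'' : Type*} [NormedAddCommGroup F]
    [NormedSpace ℝ F] [NormedAddCommGroup F'] [NormedSpace ℝ F'] [NormedAddCommGroup F'']
    [NormedSpace ℝ F''] (B : F →L[ℝ] F' →L[ℝ] F'') {k l : ℕ} (α : SimpForm n F k)
    (β : SimpForm n F' l) : SimpForm n F'' (k + l) := fun p => (α p).wedge B (β p)

/-- The canonical connection: on `Δ^p × U(n)^(p+1)` it is `t₀ θ₀ + ⋯ + t_p θ_p`, where `θ_i` is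
the pullback of the Maurer–Cartan form along the projection to the `i`-th factor. -/
noncomputable def canonicalConnection (n : ℕ) : SimpForm n (Mat n) 1 := fun p x =>
  ∑ i : Fin (p + 1), barycentric x.1 i •
    (maurerCartan n).pullback (simpModel n p) 𝓘(ℝ, ULie n)
      (fun y : (Fin p → ℝ) × NBar n p => y.2 i) x

/-- The commutator of matrices as a bilinear map. -/
noncomputable def bracketCLM (n : ℕ) : Mat n →L[ℝ] Mat n →L[ℝ] Mat n :=
  ContinuousLinearMap.mul ℝ (Mat n) - (ContinuousLinearMap.mul ℝ (Mat n)).flip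

/-- The curvature `Ω = dθ + ½ [θ, θ]`. -/
noncomputable def curvature {n : ℕ} (θ : SimpForm n (Mat n) 1) : SimpForm n (Mat n) 2 :=
  θ.d + (1 / 2 : ℝ) • θ.wedge (bracketCLM n) θ

/-- `φ_s = s Ω + ½ s (s - 1) [θ, θ]`. -/
noncomputable def curvaturePath {n : ℕ} (θ : SimpForm n (Mat n) 1) (s : ℝ) :
    SimpForm n (Mat n) 2 :=
  s • curvature θ + (1 / 2 * s * (s - 1)) • θ.wedge (bracketCLM n) θ

/-- The transgression form `TP(θ) = 2 ∫₀¹ P(θ ∧ φ_s) ds` of an invariant polynomial of degree `2`,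
given as a symmetric bilinear form `P`. -/
noncomputable def transgression {n : ℕ} (P : Mat n →L[ℝ] Mat n →L[ℝ] ℂ)
    (θ : SimpForm n (Mat n) 1) : SimpForm n ℂ 3 := fun p x =>
  (2 : ℝ) • ∫ s in (0 : ℝ)..1, θ.wedge P (curvaturePath θ s) p x

/-! ## The complex `Ω^*(N\overline{U(n)})` and integration over the simplices -/

/-- Complex-valued `q`-forms on `U(n)^(p+1)`. -/
abbrev NBarForm (n p q : ℕ) : Type := DForm (NBar n p) (NBarLie n p) ℂ q

/-- Total degree `m` part of the double complex: families of `(m-p)`-forms on `U(n)^(p+1)`,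
`0 ≤ p ≤ m`. -/
abbrev TotalForm (n m : ℕ) : Type := ∀ p : Fin (m + 1), NBarForm n p (m - p)

/-- The vertical differential: `(-1)^p` times the exterior derivative on `U(n)^(p+1)`. -/
noncomputable def verticalD {n p q : ℕ} (α : NBarForm n p q) : NBarForm n p (q + 1) :=
  (-1 : ℝ) ^ p • α.extD 𝓘(ℝ, NBarLie n p)

/-- Integration over the simplices:
`(∫_{Δ^p} α)(v) = ∫_{Δ^p} α(∂/∂t₁, …, ∂/∂t_p, v) dt₁ ⋯ dt_p`. -/
noncomputable def integrateSimplex {n m : ℕ} (α : SimpForm n ℂ m) : TotalForm n m := fun p g =>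
  ∫ t in simplex p, (altInsert (α p (t, g)) fun i : Fin p =>
      ((Pi.single i 1, 0) : (Fin p → ℝ) × NBarLie n p)).compContinuousLinearMap
    (ContinuousLinearMap.inr ℝ (Fin p → ℝ) (NBarLie n p))

/-- The Chern–Simons form in `Ω³(N\overline{U(n)})` which corresponds to `c_2`. -/
noncomputable def chernSimonsTwo (n : ℕ) : TotalForm n 3 :=
  integrateSimplex (transgression (chernTwoPol n) (canonicalConnection n))

/-! ## The explicit forms -/

/-- The matrix-valued one-form `g_i⁻¹ dg_i` on `U(n)^(p+1)`. -/
noncomputable def gInvDg (n p : ℕ) (i : Fin (p + 1)) : DForm (NBar n p) (NBarLie n p) (Mat n) 1 :=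
  (maurerCartan n).pullback 𝓘(ℝ, NBarLie n p) 𝓘(ℝ, ULie n) (fun g : NBar n p => g i)

/-- The trace as a real-linear map. -/
noncomputable def traceCLM (n : ℕ) : Mat n →L[ℝ] ℂ :=
  LinearMap.toContinuousLinearMap (Matrix.traceLinearMap (Fin n) ℝ ℂ)

/-- `(1/2πi)² (1/6) tr((g⁻¹ dg)³)` on `U(n)`. -/
noncomputable def Tc03 (n : ℕ) : NBarForm n 0 3 :=
  (1 / (2 * Real.pi * Complex.I)) ^ 2 • (1 / 6 : ℂ) •
    DForm.mapVal (traceCLM n)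
      (((gInvDg n 0 0).wedge (ContinuousLinearMap.mul ℝ (Mat n)) (gInvDg n 0 0)).wedge
        (ContinuousLinearMap.mul ℝ (Mat n)) (gInvDg n 0 0))

/-- `(1/2πi)² (½ tr(g₀⁻¹ dg₀ g₁⁻¹ dg₁) - ½ tr(g₀⁻¹ dg₀) tr(g₁⁻¹ dg₁))` on `U(n) × U(n)`. -/
noncomputable def Tc12 (n : ℕ) : NBarForm n 1 2 :=
  (1 / (2 * Real.pi * Complex.I)) ^ 2 •
    ((1 / 2 : ℂ) • DForm.mapVal (traceCLM n)
        ((gInvDg n 1 0).wedge (ContinuousLinearMap.mul ℝ (Mat n)) (gInvDg n 1 1)) -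
      (1 / 2 : ℂ) • (DForm.mapVal (traceCLM n) (gInvDg n 1 0)).wedge
        (ContinuousLinearMap.mul ℝ ℂ) (DForm.mapVal (traceCLM n) (gInvDg n 1 1)))

/-! Everything follows from the Maurer–Cartan equation `dθ_i = -θ_i ∧ θ_i`. On the product of the
simplex with the group it gives `dθ = ∑ dt_i ∧ θ_i - ∑ t_i θ_i ∧ θ_i`. Since `φ_s = s dθ + ½ s² [θ,
θ]`, the `s`-integral is `TP(θ) = P(θ ∧ dθ) + ⅓ P(θ ∧ [θ, θ])`, where `2 P(X, Y) = (1/2πi)² (tr X tr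
Y - tr XY)` (`transgression_eq`, `transgression_apply`, `chernTwoPol_eq`).

Now count the `dt`'s. The connection has none, and `dθ` has at most one, so `TP(θ)` vanishes on two
simplex directions; this kills the components `p = 2, 3`. For `p = 0` one has `dθ = -θ²` and `[θ, θ]
= 2θ²`, so `TP(θ) = -⅓ P(θ ∧ θ²)`, which is a multiple of `tr θ³` because `tr θ² = 0`. For `p = 1`,
contraction with `∂/∂t₁` leaves `-P(θ ∧ (θ₁ - θ₀))`. As `P` is symmetric, the squares of `θ₀` and
`θ₁` drop out and the cross terms have weights `(1 - t) + t = 1`, so the value is `-P(θ₀ ∧ θ₁)`,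
independent of `t`. In every degree the integrand is thus constant over the interior of the simplex,
whose frontier is null (`chernSimonsTwo_eq_of_interior`).

Closedness of `tr θ³` reduces to `tr θ⁴ = 0`: rotating four one-forms cyclically changes the sign
but not the trace (`alternating_sum_traceCubeDeriv`). Smoothness holds because, in the Cayley
charts, all forms are built by wedge products and real-linear maps from `u* du` with `u` a smooth
matrix function. -/

/-! ### Wedge products of alternating maps: evaluation in low degree, and continuity -/

section AltWedge

variable {E E' F F' F'' : Type*}
  [NormedAddCommGroup E] [NormedSpace ℝ E] [NormedAddCommGroup E'] [NormedSpace ℝ E']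
  [NormedAddCommGroup F] [NormedSpace ℝ F] [NormedAddCommGroup F'] [NormedSpace ℝ F']
  [NormedAddCommGroup F''] [NormedSpace ℝ F'']

theorem altWedge_apply (B : F →L[ℝ] F' →L[ℝ] F'') {k l : ℕ} (α : E [⋀^Fin k]→L[ℝ] F)
    (β : E [⋀^Fin l]→L[ℝ] F') (v : Fin (k + l) → E) :
    altWedge B α β v = ((Nat.factorial k * Nat.factorial l : ℝ)⁻¹) •
      ∑ σ : Equiv.Perm (Fin (k + l)), Equiv.Perm.sign σ •
        B (α fun i => v (σ (Fin.castAdd l i))) (β fun j => v (σ (Fin.natAdd k j))) := by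
  simp only [altWedge, ContinuousAlternatingMap.smul_apply,
    ContinuousMultilinearMap.alternatization_apply_apply]
  rfl

theorem altWedge_add_right (B : F →L[ℝ] F' →L[ℝ] F'') {k l : ℕ} (α : E [⋀^Fin k]→L[ℝ] F)
    (β β' : E [⋀^Fin l]→L[ℝ] F') :
    altWedge B α (β + β') = altWedge B α β + altWedge B α β' := by
  ext v
  simp [altWedge_apply, Finset.sum_add_distrib]

theorem altWedge_add_left (B : F →L[ℝ] F' →L[ℝ] F'') {k l : ℕ} (α α' : E [⋀^Fin k]→L[ℝ] F)
    (β : E [⋀^Fin l]→L[ℝ] F') :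
    altWedge B (α + α') β = altWedge B α β + altWedge B α' β := by
  ext v
  simp [altWedge_apply, Finset.sum_add_distrib]

theorem altWedge_smul_right (B : F →L[ℝ] F' →L[ℝ] F'') {k l : ℕ} (c : ℝ)
    (α : E [⋀^Fin k]→L[ℝ] F) (β : E [⋀^Fin l]→L[ℝ] F') :
    altWedge B α (c • β) = c • altWedge B α β := by
  ext v
  simp only [altWedge_apply, ContinuousAlternatingMap.smul_apply, map_smul, Finset.smul_sum,
    smul_comm c]

theorem altWedge_smul_left (B : F →L[ℝ] F' →L[ℝ] F'') {k l : ℕ} (c : ℝ)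
    (α : E [⋀^Fin k]→L[ℝ] F) (β : E [⋀^Fin l]→L[ℝ] F') :
    altWedge B (c • α) β = c • altWedge B α β := by
  ext v
  simp only [altWedge_apply, ContinuousAlternatingMap.smul_apply, map_smul, Finset.smul_sum,
    smul_comm c, smul_apply]

theorem altWedge_compContinuousLinearMap (B : F →L[ℝ] F' →L[ℝ] F'') {k l : ℕ}
    (α : E' [⋀^Fin k]→L[ℝ] F) (β : E' [⋀^Fin l]→L[ℝ] F') (f : E →L[ℝ] E') :
    (altWedge B α β).compContinuousLinearMap f =
      altWedge B (α.compContinuousLinearMap f) (β.compContinuousLinearMap f) := by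
  ext v
  simp only [altWedge_apply, ContinuousAlternatingMap.compContinuousLinearMap_apply]
  rfl

theorem altWedge_one_one_apply (B : F →L[ℝ] F' →L[ℝ] F'') (α : E [⋀^Fin 1]→L[ℝ] F)
    (β : E [⋀^Fin 1]→L[ℝ] F') (v : Fin 2 → E) :
    altWedge B α β v = B (α ![v 0]) (β ![v 1]) - B (α ![v 1]) (β ![v 0]) := by
  have hu : (Finset.univ : Finset (Equiv.Perm (Fin (1 + 1)))) = {1, Equiv.swap 0 1} := by decide
  have h : ∀ w : Fin 1 → E, w = ![w 0] := fun w => by ext i; fin_cases i; rfl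
  rw [altWedge_apply, hu, Finset.sum_pair (by decide)]
  simp only [Equiv.Perm.sign_one, one_smul, Equiv.Perm.sign_swap (show (0 : Fin 2) ≠ 1 by decide)]
  rw [h fun i => v ((1 : Equiv.Perm (Fin 2)) (Fin.castAdd 1 i)),
    h fun i => v ((1 : Equiv.Perm (Fin 2)) (Fin.natAdd 1 i)),
    h fun i => v (Equiv.swap 0 1 (Fin.castAdd 1 i)),
    h fun i => v (Equiv.swap 0 1 (Fin.natAdd 1 i))]
  simp [sub_eq_add_neg]

theorem sum_perm_fin_three {A : Type*} [AddCommMonoid A] (f : Equiv.Perm (Fin 3) → A) :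
    ∑ σ, f σ = f 1 + f (Equiv.swap 0 1) + f (Equiv.swap 0 2) + f (Equiv.swap 1 2) +
      f (Equiv.swap 0 1 * Equiv.swap 1 2) + f (Equiv.swap 1 2 * Equiv.swap 0 1) := by
  have hu : (Finset.univ : Finset (Equiv.Perm (Fin 3))) = {1, Equiv.swap 0 1, Equiv.swap 0 2,
      Equiv.swap 1 2, Equiv.swap 0 1 * Equiv.swap 1 2, Equiv.swap 1 2 * Equiv.swap 0 1} := by
    decide
  rw [hu]
  iterate 5 rw [Finset.sum_insert (by decide)]
  rw [Finset.sum_singleton]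
  simp only [add_assoc]

theorem ContinuousAlternatingMap.apply_swap_fin_two (β : E [⋀^Fin 2]→L[ℝ] F) (x y : E) :
    β ![y, x] = -β ![x, y] := by
  refine Eq.trans ?_ (β.toAlternatingMap.map_swap ![x, y] (show (0 : Fin 2) ≠ 1 by decide))
  refine congrArg β ?_
  ext i
  fin_cases i <;> rfl

/-- The six permutations pair off under exchange of the two arguments of `β`; the antisymmetry of
`β` makes each pair equal, and `1 / (1! 2!)` removes the doubling. -/
theorem altWedge_one_two_apply (B : F →L[ℝ] F' →L[ℝ] F'') (α : E [⋀^Fin 1]→L[ℝ] F)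
    (β : E [⋀^Fin 2]→L[ℝ] F') (v : Fin 3 → E) :
    altWedge B α β v = B (α ![v 0]) (β ![v 1, v 2]) - B (α ![v 1]) (β ![v 0, v 2]) +
      B (α ![v 2]) (β ![v 0, v 1]) := by
  have h : ∀ w : Fin 1 → E, w = ![w 0] := fun w => by ext i; fin_cases i; rfl
  have h2 : ∀ w : Fin 2 → E, w = ![w 0, w 1] := fun w => by ext i; fin_cases i <;> rfl
  have key : ∀ σ : Equiv.Perm (Fin 3),
      B (α fun i => v (σ (Fin.castAdd 2 i))) (β fun j => v (σ (Fin.natAdd 1 j))) =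
        B (α ![v (σ 0)]) (β ![v (σ 1), v (σ 2)]) := fun σ => by
    rw [h fun i => v (σ (Fin.castAdd 2 i)), h2 fun j => v (σ (Fin.natAdd 1 j))]; rfl
  rw [altWedge_apply]
  refine (congrArg _ (Finset.sum_congr rfl fun σ _ => congrArg _ (key σ))).trans ?_
  rw [sum_perm_fin_three]
  have e1 : (Equiv.swap (1 : Fin 3) 2) 0 = 0 := by decide
  have e2 : (Equiv.swap (0 : Fin 3) 1) 2 = 2 := by decide
  have e3 : (Equiv.swap (0 : Fin 3) 2) 1 = 1 := by decide
  simp only [map_mul, Equiv.Perm.sign_one, Equiv.Perm.sign_swap (show (0 : Fin 3) ≠ 1 by decide),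
    Equiv.Perm.sign_swap (show (0 : Fin 3) ≠ 2 by decide),
    Equiv.Perm.sign_swap (show (1 : Fin 3) ≠ 2 by decide), Equiv.Perm.mul_apply,
    Equiv.swap_apply_left, Equiv.swap_apply_right, Equiv.Perm.one_apply, e1, e2, e3]
  rw [β.apply_swap_fin_two (v 0) (v 1), β.apply_swap_fin_two (v 0) (v 2),
    β.apply_swap_fin_two (v 1) (v 2)]
  simp only [map_neg, Units.neg_smul, one_smul, mul_neg, mul_one, neg_neg, Nat.factorial]
  module

theorem altWedge_two_one_apply (B : F →L[ℝ] F' →L[ℝ] F'') (α : E [⋀^Fin 2]→L[ℝ] F)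
    (β : E [⋀^Fin 1]→L[ℝ] F') (v : Fin 3 → E) :
    altWedge B α β v = B (α ![v 0, v 1]) (β ![v 2]) - B (α ![v 0, v 2]) (β ![v 1]) +
      B (α ![v 1, v 2]) (β ![v 0]) := by
  have h : ∀ w : Fin 1 → E, w = ![w 0] := fun w => by ext i; fin_cases i; rfl
  have h2 : ∀ w : Fin 2 → E, w = ![w 0, w 1] := fun w => by ext i; fin_cases i <;> rfl
  have key : ∀ σ : Equiv.Perm (Fin 3),
      B (α fun i => v (σ (Fin.castAdd 1 i))) (β fun j => v (σ (Fin.natAdd 2 j))) =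
        B (α ![v (σ 0), v (σ 1)]) (β ![v (σ 2)]) := fun σ => by
    rw [h2 fun i => v (σ (Fin.castAdd 1 i)), h fun j => v (σ (Fin.natAdd 2 j))]; rfl
  rw [altWedge_apply]
  refine (congrArg _ (Finset.sum_congr rfl fun σ _ => congrArg _ (key σ))).trans ?_
  rw [sum_perm_fin_three]
  have e1 : (Equiv.swap (1 : Fin 3) 2) 0 = 0 := by decide
  have e2 : (Equiv.swap (0 : Fin 3) 1) 2 = 2 := by decide
  have e3 : (Equiv.swap (0 : Fin 3) 2) 1 = 1 := by decide
  simp only [map_mul, Equiv.Perm.sign_one, Equiv.Perm.sign_swap (show (0 : Fin 3) ≠ 1 by decide),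
    Equiv.Perm.sign_swap (show (0 : Fin 3) ≠ 2 by decide),
    Equiv.Perm.sign_swap (show (1 : Fin 3) ≠ 2 by decide), Equiv.Perm.mul_apply,
    Equiv.swap_apply_left, Equiv.swap_apply_right, Equiv.Perm.one_apply, e1, e2, e3]
  rw [α.apply_swap_fin_two (v 0) (v 1), α.apply_swap_fin_two (v 0) (v 2),
    α.apply_swap_fin_two (v 1) (v 2)]
  simp only [map_neg, neg_apply, Units.neg_smul, one_smul, mul_neg, mul_one, neg_neg,
    Nat.factorial]
  module

theorem norm_altTensor_le (B : F →L[ℝ] F' →L[ℝ] F'') {k l : ℕ} (α : E [⋀^Fin k]→L[ℝ] F)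
    (β : E [⋀^Fin l]→L[ℝ] F') (v : Fin (k + l) → E) :
    ‖altTensor B α β v‖ ≤ ‖B‖ * ‖α‖ * ‖β‖ * ∏ i, ‖v i‖ := by
  refine (B.le_opNorm₂ (α fun i => v (Fin.castAdd l i)) (β fun j => v (Fin.natAdd k j))).trans ?_
  rw [Fin.prod_univ_add]
  calc _ ≤ ‖B‖ * (‖α‖ * ∏ i, ‖v (Fin.castAdd l i)‖) * (‖β‖ * ∏ j, ‖v (Fin.natAdd k j)‖) := by
        gcongr
        · exact α.le_opNorm _
        · exact β.le_opNorm _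
    _ = _ := by ring

/-- A crude bound suffices: it only serves to make the wedge product a continuous bilinear map,
hence smooth. -/
theorem norm_altWedge_le (B : F →L[ℝ] F' →L[ℝ] F'') {k l : ℕ} (α : E [⋀^Fin k]→L[ℝ] F)
    (β : E [⋀^Fin l]→L[ℝ] F') :
    ‖altWedge B α β‖ ≤ (k + l).factorial * ‖B‖ * ‖α‖ * ‖β‖ := by
  have h0 : 0 ≤ (k + l).factorial * ‖B‖ * ‖α‖ * ‖β‖ := by positivity
  refine ContinuousAlternatingMap.opNorm_le_bound (altWedge B α β) h0 fun v => ?_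
  rw [altWedge, ContinuousAlternatingMap.smul_apply,
    ContinuousMultilinearMap.alternatization_apply_apply, norm_smul]
  -- The normalising factor is simply estimated by 1; the number of permutations gives the factorial
  -- in the bound.
  have h1 : ‖((Nat.factorial k * Nat.factorial l : ℝ)⁻¹)‖ ≤ 1 := by
    rw [norm_inv]
    refine inv_le_one_of_one_le₀ ?_
    rw [← Nat.cast_mul, Real.norm_natCast, Nat.one_le_cast]
    exact Nat.mul_pos k.factorial_pos l.factorial_pos
  have h2 : ‖∑ σ : Equiv.Perm (Fin (k + l)), Equiv.Perm.sign σ • altTensor B α β (v ∘ σ)‖ ≤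
      (k + l).factorial * (‖B‖ * ‖α‖ * ‖β‖ * ∏ i, ‖v i‖) := by
    refine (norm_sum_le_of_le _ (f := fun σ : Equiv.Perm (Fin (k + l)) =>
      Equiv.Perm.sign σ • altTensor B α β (v ∘ σ))
      (n := fun _ => ‖B‖ * ‖α‖ * ‖β‖ * ∏ i, ‖v i‖) fun σ _ => ?_).trans ?_
    · have : ‖Equiv.Perm.sign σ • altTensor B α β (v ∘ σ)‖ = ‖altTensor B α β (v ∘ σ)‖ := by
        rcases Int.units_eq_one_or (Equiv.Perm.sign σ) with h | h <;> simp [h]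
      rw [this]
      refine (norm_altTensor_le B α β _).trans_eq ?_
      congr 1
      exact Equiv.prod_comp σ fun i => ‖v i‖
    · simp [Fintype.card_perm]
  calc _ ≤ 1 * ((k + l).factorial * (‖B‖ * ‖α‖ * ‖β‖ * ∏ i, ‖v i‖)) := by gcongr
    _ = _ := by ring

/-- The wedge product of alternating maps as a continuous bilinear map. -/
noncomputable def altWedgeL (B : F →L[ℝ] F' →L[ℝ] F'') (k l : ℕ) :
    (E [⋀^Fin k]→L[ℝ] F) →L[ℝ] (E [⋀^Fin l]→L[ℝ] F') →L[ℝ] (E [⋀^Fin (k + l)]→L[ℝ] F'') :=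
  LinearMap.mkContinuous₂
    (LinearMap.mk₂ ℝ (altWedge B) (altWedge_add_left B) (altWedge_smul_left B)
      (altWedge_add_right B) (altWedge_smul_right B))
    ((k + l).factorial * ‖B‖) (norm_altWedge_le B)

theorem contDiffOn_altWedge {G : Type*} [NormedAddCommGroup G] [NormedSpace ℝ G]
    (B : F →L[ℝ] F' →L[ℝ] F'') {k l : ℕ} {r : ℕ∞ω} {s : Set G}
    {α : G → E [⋀^Fin k]→L[ℝ] F} {β : G → E [⋀^Fin l]→L[ℝ] F'}
    (hα : ContDiffOn ℝ r α s) (hβ : ContDiffOn ℝ r β s) :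
    ContDiffOn ℝ r (fun x => altWedge B (α x) (β x)) s := by
  have h1 : ContDiffOn ℝ r (fun x => altWedgeL B k l (α x)) s :=
    ContDiff.comp_contDiffOn (ContinuousLinearMap.contDiff (𝕜 := ℝ) (E := E [⋀^Fin k]→L[ℝ] F)
      (F := (E [⋀^Fin l]→L[ℝ] F') →L[ℝ] (E [⋀^Fin (k + l)]→L[ℝ] F'')) (altWedgeL B k l)) hα
  exact h1.clm_apply hβ

end AltWedge

/-! ### Differential forms read in charts -/

section Charts

variable {E E' F F' F'' H H' M M' : Type*}
  [NormedAddCommGroup E] [NormedSpace ℝ E] [NormedAddCommGroup E'] [NormedSpace ℝ E']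
  [NormedAddCommGroup F] [NormedSpace ℝ F] [NormedAddCommGroup F'] [NormedSpace ℝ F']
  [NormedAddCommGroup F''] [NormedSpace ℝ F'']
  [TopologicalSpace H] [TopologicalSpace H']
  [TopologicalSpace M] [ChartedSpace H M] [TopologicalSpace M'] [ChartedSpace H' M']
  (I : ModelWithCorners ℝ E H) (I' : ModelWithCorners ℝ E' H')

theorem ContinuousAlternatingMap.sum_smul_compContinuousLinearMap {ι : Type*} (s : Finset ι)
    {k : ℕ} (c : ι → ℝ) (α : ι → E' [⋀^Fin k]→L[ℝ] F) (f : E →L[ℝ] E') :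
    (∑ i ∈ s, c i • α i).compContinuousLinearMap f =
      ∑ i ∈ s, c i • (α i).compContinuousLinearMap f := by
  ext v
  simp [ContinuousAlternatingMap.sum_apply]

/-- The tangent space at `x` is identified with the model space through the chart at `x` itself, so
that chart has identity derivative there. Each pointwise identity may therefore be checked in the
chart centred at the point. -/
theorem DForm.inChart_self [IsManifold I 1 M] {k : ℕ} (η : DForm M E F k) (x : M) :
    η.inChart I x (extChartAt I x x) = η x := by
  unfold DForm.inChart
  rw [extChartAt_to_inv]
  exact congrArg (ContinuousAlternatingMap.compContinuousLinearMap _)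
    (mfderivWithin_range_extChartAt_symm (I := I) (x := x))

theorem DForm.extDWithin_eq [IsManifold I 1 M] {k : ℕ} (η : DForm M E F k) (s : Set M) (x : M) :
    η.extDWithin I s x = extDerivWithin (η.inChart I x)
      ((extChartAt I x).symm ⁻¹' s ∩ Set.range I) (extChartAt I x x) := by
  unfold DForm.extDWithin
  exact congrArg (ContinuousAlternatingMap.compContinuousLinearMap _)
    (mfderiv_extChartAt_self (I := I) (x := x))

theorem DForm.extD_eq [IsManifold I 1 M] [I.Boundaryless] {k : ℕ} (η : DForm M E F k) (x : M) :
    η.extD I x = extDeriv (η.inChart I x) (extChartAt I x x) := by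
  rw [DForm.extD, DForm.extDWithin_eq, Set.preimage_univ, Set.univ_inter, I.range_eq_univ,
    extDerivWithin_univ]

theorem DForm.inChart_wedge (B : F →L[ℝ] F' →L[ℝ] F'') {k l : ℕ} (α : DForm M E F k)
    (β : DForm M E F' l) (x : M) (y : E) :
    (α.wedge B β).inChart I x y = altWedge B (α.inChart I x y) (β.inChart I x y) :=
  altWedge_compContinuousLinearMap B _ _ _

theorem DForm.inChart_mapVal (L : F →L[ℝ] F') {k : ℕ} (α : DForm M E F k) (x : M) (y : E) :
    (DForm.mapVal L α).inChart I x y = L.compContinuousAlternatingMap (α.inChart I x y) := rfl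

variable {I I'} in
theorem DForm.inChart_pullback [I.Boundaryless] [IsManifold I 1 M] {k : ℕ} {η : DForm M' E' F k}
    {f : M → M'} (x : M) {y : E} (hy : y ∈ (extChartAt I x).target)
    (hf : MDifferentiableAt I I' f ((extChartAt I x).symm y)) :
    (η.pullback I I' f).inChart I x y =
      η.pullback 𝓘(ℝ, E) I' (f ∘ (extChartAt I x).symm) y := by
  have h1 := mdifferentiableWithinAt_extChartAt_symm (I := I) hy
  unfold DForm.inChart DForm.pullback
  rw [I.range_eq_univ] at h1 ⊢
  rw [mdifferentiableWithinAt_univ] at h1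
  have h2 := mfderiv_comp y hf h1
  rw [mfderivWithin_univ, h2]
  rfl

end Charts

/-! ### The Maurer–Cartan form and the canonical connection in Cayley charts -/

section MaurerCartan

variable {n : ℕ}

theorem continuous_coe_unitary : Continuous fun g : UGrp n => (g : Mat n) :=
  continuous_subtype_val

theorem contMDiff_coe_unitary :
    ContMDiff 𝓘(ℝ, ULie n) 𝓘(ℝ, Mat n) ∞ fun g : UGrp n => (g : Mat n) := by
  intro g
  rw [contMDiffAt_iff]
  refine ⟨continuous_coe_unitary.continuousAt, ?_⟩
  have h : (extChartAt 𝓘(ℝ, Mat n) (g : Mat n) ∘ (fun h : UGrp n => (h : Mat n)) ∘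
      (extChartAt 𝓘(ℝ, ULie n) g).symm) =
      fun A : ULie n => (g : Mat n) * cayleyInvMat (A : Mat n) := by
    funext A
    exact congrArg Subtype.val (cayleyChartAt_symm_apply g A)
  rw [h]
  refine ContDiffAt.contDiffWithinAt ?_
  exact contDiffAt_const.mul ((contDiffAt_cayleyInvMat (ULie.isUnit_one_sub _)).comp _
    (Submodule.subtypeL (skewAdjoint.submodule ℝ (Mat n))).contDiff.contDiffAt)

/-- The form `u* du` of a matrix-valued function `u` on a normed space. -/
noncomputable def starMulDeriv {E : Type*} [NormedAddCommGroup E] [NormedSpace ℝ E]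
    (u : E → Mat n) (y : E) : E [⋀^Fin 1]→L[ℝ] Mat n :=
  ContinuousAlternatingMap.ofSubsingleton ℝ E (Mat n) (0 : Fin 1)
    ((ContinuousLinearMap.mul ℝ (Mat n) (star (u y))).comp (fderiv ℝ u y))

/-- The chain rule for the inclusion of `U(n)` into the matrices. The group inverse is the adjoint,
a real-linear operation, so no derivative of matrix inversion is ever needed. -/
theorem maurerCartan_pullback_eq {E : Type*} [NormedAddCommGroup E] [NormedSpace ℝ E]
    {f : E → UGrp n} {y : E} (hf : MDifferentiableAt 𝓘(ℝ, E) 𝓘(ℝ, ULie n) f y) :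
    (maurerCartan n).pullback 𝓘(ℝ, E) 𝓘(ℝ, ULie n) f y =
      starMulDeriv (fun z => (f z : Mat n)) y := by
  have h1 : MDifferentiableAt 𝓘(ℝ, ULie n) 𝓘(ℝ, Mat n) (fun g : UGrp n => (g : Mat n)) (f y) :=
    (contMDiff_coe_unitary (f y)).mdifferentiableAt (by simp)
  have h2 := mfderiv_comp y h1 hf
  have h3 : fderiv ℝ (fun z => (f z : Mat n)) y =
      mfderiv 𝓘(ℝ, E) 𝓘(ℝ, Mat n) ((fun g : UGrp n => (g : Mat n)) ∘ f) y :=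
    (mfderiv_eq_fderiv (f := fun z => (f z : Mat n))).symm
  ext v : 1
  refine congrArg (star (f y : Mat n) * ·) ?_
  exact (DFunLike.congr_fun (h3.trans h2) (v 0)).symm

/-- Because `1 - A` is invertible for every skew-Hermitian `A`, the inverse Cayley chart is defined
on all of `𝔲(n)`; chart expressions below are functions on the whole model space. -/
theorem mem_cayleyChartAt_target (g : UGrp n) (A : ULie n) : A ∈ (cayleyChartAt g).target := by
  simp [cayleyChartAt, cayleyChart]

theorem mem_extChartAt_nbar_target {p : ℕ} (g : NBar n p) (A : NBarLie n p) :
    A ∈ (extChartAt 𝓘(ℝ, NBarLie n p) g).target := by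
  rw [extChartAt_target]
  refine ⟨fun i _ => ?_, Set.mem_range_self _⟩
  exact (mem_cayleyChartAt_target (g i) (A i))

theorem contMDiff_nbar_apply {p : ℕ} (i : Fin (p + 1)) :
    ContMDiff 𝓘(ℝ, NBarLie n p) 𝓘(ℝ, ULie n) ∞ fun g : NBar n p => g i := by
  intro g
  rw [contMDiffAt_iff]
  refine ⟨(continuous_apply i).continuousAt, ?_⟩
  have h : (extChartAt 𝓘(ℝ, ULie n) (g i) ∘ (fun g : NBar n p => g i) ∘
      (extChartAt 𝓘(ℝ, NBarLie n p) g).symm) = fun A : NBarLie n p => A i := by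
    funext A
    exact (cayleyChartAt (g i)).right_inv (mem_cayleyChartAt_target _ _)
  rw [h]
  exact (contDiff_apply ℝ (ULie n) i).contDiffWithinAt

theorem mem_extChartAt_simp_target {p : ℕ} (x : (Fin p → ℝ) × NBar n p)
    (A : (Fin p → ℝ) × NBarLie n p) : A ∈ (extChartAt (simpModel n p) x).target := by
  rw [extChartAt_prod]
  exact ⟨⟨Set.mem_univ _, Set.mem_univ _⟩, mem_extChartAt_nbar_target x.2 A.2⟩

theorem extChartAt_simp_symm_apply {p : ℕ} (x : (Fin p → ℝ) × NBar n p)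
    (A : (Fin p → ℝ) × NBarLie n p) : (extChartAt (simpModel n p) x).symm A =
      (A.1, (extChartAt 𝓘(ℝ, NBarLie n p) x.2).symm A.2) := by
  rw [extChartAt_prod]
  rfl

theorem extChartAt_simp_apply {p : ℕ} (x y : (Fin p → ℝ) × NBar n p) :
    extChartAt (simpModel n p) x y = (y.1, extChartAt 𝓘(ℝ, NBarLie n p) x.2 y.2) := by
  rw [extChartAt_prod]
  rfl

/-- The `i`-th matrix on `U(n)^(p+1)` in the chart around `g`. -/
noncomputable def nbarCoord {p : ℕ} (g : NBar n p) (i : Fin (p + 1)) (A : NBarLie n p) : Mat n :=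
  ((cayleyChartAt (g i)).symm (A i) : UGrp n)

theorem contDiff_nbarCoord {p : ℕ} (g : NBar n p) (i : Fin (p + 1)) :
    ContDiff ℝ ∞ (nbarCoord g i) := by
  have h : nbarCoord g i = fun A : NBarLie n p => (g i : Mat n) * cayleyInvMat (A i : Mat n) := by
    funext A
    exact congrArg Subtype.val (cayleyChartAt_symm_apply (g i) (A i))
  rw [h, contDiff_iff_contDiffAt]
  intro A
  have h1 : ContDiffAt ℝ ∞ (fun A : NBarLie n p => (A i : Mat n)) A :=
    ((Submodule.subtypeL (skewAdjoint.submodule ℝ (Mat n))).contDiff.comp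
      (contDiff_apply ℝ (ULie n) i)).contDiffAt
  exact contDiffAt_const.mul
    (ContDiffAt.comp A (contDiffAt_cayleyInvMat (ULie.isUnit_one_sub (A i))) h1)

theorem star_nbarCoord_mul_self {p : ℕ} (g : NBar n p) (i : Fin (p + 1)) (A : NBarLie n p) :
    star (nbarCoord g i A) * nbarCoord g i A = 1 :=
  Matrix.mem_unitaryGroup_iff'.1 (Subtype.prop _)

theorem gInvDg_inChart {p : ℕ} (i : Fin (p + 1)) (g : NBar n p) (A : NBarLie n p) :
    (gInvDg n p i).inChart 𝓘(ℝ, NBarLie n p) g A = starMulDeriv (nbarCoord g i) A := by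
  have h1 : MDifferentiableAt 𝓘(ℝ, NBarLie n p) 𝓘(ℝ, ULie n) (fun g : NBar n p => g i)
      ((extChartAt 𝓘(ℝ, NBarLie n p) g).symm A) :=
    (contMDiff_nbar_apply i _).mdifferentiableAt (by simp)
  have h2 := mdifferentiableWithinAt_extChartAt_symm (mem_extChartAt_nbar_target g A)
  rw [ModelWithCorners.range_eq_univ, mdifferentiableWithinAt_univ] at h2
  refine (DForm.inChart_pullback g (mem_extChartAt_nbar_target g A) h1).trans ?_
  exact maurerCartan_pullback_eq (h1.comp A h2)

theorem canonicalConnection_inChart {p : ℕ} (x : (Fin p → ℝ) × NBar n p)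
    (A : (Fin p → ℝ) × NBarLie n p) :
    (canonicalConnection n p).inChart (simpModel n p) x A = ∑ i, barycentric A.1 i •
      starMulDeriv (fun z : (Fin p → ℝ) × NBarLie n p => nbarCoord x.2 i z.2) A := by
  have h1 : ∀ i, MDifferentiableAt (simpModel n p) 𝓘(ℝ, ULie n)
      (fun y : (Fin p → ℝ) × NBar n p => y.2 i) ((extChartAt (simpModel n p) x).symm A) :=
    fun i => (((contMDiff_nbar_apply i).comp contMDiff_snd) _).mdifferentiableAt (by simp)
  have h2 := mdifferentiableWithinAt_extChartAt_symm (mem_extChartAt_simp_target x A)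
  rw [ModelWithCorners.range_eq_univ, mdifferentiableWithinAt_univ] at h2
  have h3 : ∀ i, ((maurerCartan n).pullback (simpModel n p) 𝓘(ℝ, ULie n)
      (fun y : (Fin p → ℝ) × NBar n p => y.2 i)).inChart (simpModel n p) x A =
        starMulDeriv (fun z : (Fin p → ℝ) × NBarLie n p => nbarCoord x.2 i z.2) A := fun i => by
    refine (DForm.inChart_pullback x (mem_extChartAt_simp_target x A) (h1 i)).trans ?_
    refine (maurerCartan_pullback_eq ((h1 i).comp A h2)).trans ?_
    congr 1
  simp only [← h3]
  unfold DForm.inChart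
  refine (ContinuousAlternatingMap.sum_smul_compContinuousLinearMap _ _ _ _).trans ?_
  rw [extChartAt_simp_symm_apply]

end MaurerCartan

/-! ### Differentiating `u* du` for a unitary matrix function -/

section StarMulDeriv

theorem minSmoothness_two_le_infty : minSmoothness ℝ 2 ≤ (∞ : ℕ∞ω) := by
  rw [minSmoothness_of_isRCLikeNormedField]
  exact WithTop.coe_le_coe.2 le_top

variable {n : ℕ} {E : Type*} [NormedAddCommGroup E] [NormedSpace ℝ E] {u : E → Mat n}

theorem starMulDeriv_apply (u : E → Mat n) (y : E) (v : Fin 1 → E) :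
    starMulDeriv u y v = star (u y) * fderiv ℝ u y (v 0) := rfl

theorem contDiff_mul_star_comp_fderiv (hu : ContDiff ℝ ∞ u) : ContDiff ℝ ∞ fun y =>
    (ContinuousLinearMap.mul ℝ (Mat n) (star (u y))).comp (fderiv ℝ u y) := by
  have h1 : ContDiff ℝ ∞ (fderiv ℝ u) := hu.fderiv_right le_rfl
  have h2 : ContDiff ℝ ∞ fun y => star (u y) :=
    (starL' ℝ : Mat n ≃L[ℝ] Mat n).contDiff.comp hu
  have h3 : ContDiff ℝ ∞ fun y => ContinuousLinearMap.mul ℝ (Mat n) (star (u y)) :=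
    (ContinuousLinearMap.mul ℝ (Mat n)).contDiff.comp h2
  exact h3.clm_comp h1

theorem differentiableAt_ofSubsingletonLIE {F G : Type*} [NormedAddCommGroup F] [NormedSpace ℝ F]
    [NormedAddCommGroup G] [NormedSpace ℝ G] {f : G → E →L[ℝ] F} {x : G}
    (hf : DifferentiableAt ℝ f x) : DifferentiableAt ℝ
      (fun y => ContinuousAlternatingMap.ofSubsingletonLIE (𝕜 := ℝ) (0 : Fin 1) (f y)) x := by
  let e := ContinuousAlternatingMap.ofSubsingletonLIE (𝕜 := ℝ) (E := E) (F := F) (0 : Fin 1)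
  have h : DifferentiableAt ℝ e (f x) := e.differentiable (f x)
  exact h.comp x hf

theorem contDiff_starMulDeriv (hu : ContDiff ℝ ∞ u) : ContDiff ℝ ∞ (starMulDeriv u) :=
  (ContinuousAlternatingMap.ofSubsingletonLIE (𝕜 := ℝ) (E := E) (F := Mat n)
    (0 : Fin 1)).contDiff.comp (contDiff_mul_star_comp_fderiv hu)

/-- The Maurer–Cartan equation before antisymmetrization: the second-derivative term is symmetric in
`v`, `w` and disappears from the exterior derivative, leaving `-θ ∧ θ`. -/
theorem hasFDerivAt_starMulDeriv_apply (hu : ContDiff ℝ ∞ u)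
    (hs : ∀ y, star (u y) * u y = 1) (y v w : E) :
    ∃ L : E →L[ℝ] Mat n, HasFDerivAt (fun z => starMulDeriv u z ![v]) L y ∧
      L w = star (u y) * fderiv ℝ (fderiv ℝ u) y w v -
        starMulDeriv u y ![w] * starMulDeriv u y ![v] := by
  have h1 : HasFDerivAt u (fderiv ℝ u y) y := (hu.differentiable (by simp) y).hasFDerivAt
  have h2 : HasFDerivAt (fun z => star (u z))
      (((starL' ℝ : Mat n ≃L[ℝ] Mat n) : Mat n →L[ℝ] Mat n).comp (fderiv ℝ u y)) y :=
    (starL' ℝ : Mat n ≃L[ℝ] Mat n).hasFDerivAt.comp y h1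
  have h3 : ContDiff ℝ ∞ (fderiv ℝ u) := hu.fderiv_right le_rfl
  have h4 : HasFDerivAt (fun z => fderiv ℝ u z v)
      ((fderiv ℝ (fderiv ℝ u) y).flip v) y := by
    simpa using (h3.differentiable (by simp) y).hasFDerivAt.clm_apply (hasFDerivAt_const v y)
  refine ⟨_, h2.mul' h4, ?_⟩
  -- The derivative of the constant function `u* u = 1`.
  have h5 : star (fderiv ℝ u y w) * u y + star (u y) * fderiv ℝ u y w = 0 := by
    have h6 := h2.mul' h1
    have h7 : HasFDerivAt (fun z => star (u z) * u z) (0 : E →L[ℝ] Mat n) y := by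
      simp only [hs]; exact hasFDerivAt_const _ _
    have h8 := DFunLike.congr_fun (h6.unique h7) w
    simpa [add_comm] using h8
  have h9 : star (fderiv ℝ u y w) = -(star (u y) * fderiv ℝ u y w * star (u y)) := by
    -- For square matrices a left inverse is also a right inverse.
    have h10 : u y * star (u y) = 1 := mul_eq_one_comm.1 (hs y)
    rw [← eq_neg_iff_add_eq_zero] at h5
    rw [← neg_mul, ← h5, mul_assoc, h10, mul_one]
  simp only [starMulDeriv_apply, Matrix.cons_val_zero]
  rw [sub_eq_add_neg]
  have h10 : star (fderiv ℝ u y w) * fderiv ℝ u y v =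
      -(star (u y) * fderiv ℝ u y w * (star (u y) * fderiv ℝ u y v)) := by
    rw [h9, neg_mul, mul_assoc _ (star (u y))]
  rw [← h10]
  rfl

end StarMulDeriv

/-! ### Integration over the simplex and its barycentric coordinates -/

section Simplex

theorem convex_simplex (p : ℕ) : Convex ℝ (simplex p) := by
  intro x hx y hy a b ha hb hab
  refine ⟨fun i => add_nonneg (mul_nonneg ha (hx.1 i)) (mul_nonneg hb (hy.1 i)), ?_⟩
  have h : ∑ i, (a • x + b • y) i = a * ∑ i, x i + b * ∑ i, y i := by
    simp [Finset.sum_add_distrib, Finset.mul_sum]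
  rw [h]
  nlinarith [mul_le_mul_of_nonneg_left hx.2 ha, mul_le_mul_of_nonneg_left hy.2 hb]

/-- The simplex is convex, so it is null-measurable with null frontier. Boundary points, where the
exterior derivative is one-sided, can thus be ignored. -/
theorem setIntegral_simplex_of_interior {F : Type*} [NormedAddCommGroup F] [NormedSpace ℝ F]
    [CompleteSpace F] {p : ℕ} {f : (Fin p → ℝ) → F} {c : F}
    (h : ∀ t ∈ interior (simplex p), f t = c) :
    ∫ t in simplex p, f t = MeasureTheory.volume.real (simplex p) • c := by
  have h1 := (convex_simplex p).addHaar_frontier MeasureTheory.volume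
  have h2 : MeasureTheory.NullMeasurableSet (simplex p) :=
    (convex_simplex p).nullMeasurableSet (μ := MeasureTheory.volume)
  rw [← MeasureTheory.setIntegral_const]
  refine MeasureTheory.integral_congr_ae ?_
  have h3 : ∀ᵐ t, t ∉ frontier (simplex p) := MeasureTheory.measure_eq_zero_iff_ae_notMem.1 h1
  filter_upwards [MeasureTheory.ae_restrict_of_ae h3,
    MeasureTheory.ae_restrict_mem₀ h2] with t ht1 ht2
  refine h t ?_
  by_contra h4
  exact ht1 ⟨subset_closure ht2, h4⟩

theorem volume_simplex_zero : MeasureTheory.volume.real (simplex 0) = 1 := by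
  have h : simplex 0 = Set.Icc 0 1 := by ext t; simp [simplex]
  rw [h, MeasureTheory.measureReal_def, Real.volume_Icc_pi]
  simp

theorem volume_simplex_one : MeasureTheory.volume.real (simplex 1) = 1 := by
  have h : simplex 1 = Set.Icc 0 1 := by
    ext t
    simp [simplex, Pi.le_def]
  rw [h, MeasureTheory.measureReal_def, Real.volume_Icc_pi]
  simp

theorem hasFDerivAt_barycentric {p : ℕ} (t : Fin p → ℝ) (i : Fin (p + 1)) :
    ∃ L : (Fin p → ℝ) →L[ℝ] ℝ, HasFDerivAt (fun t => barycentric t i) L t ∧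
      ∀ s, L s = (Fin.cons (-∑ j, s j) s : Fin (p + 1) → ℝ) i := by
  induction i using Fin.cases with
  | zero =>
    refine ⟨_, (hasFDerivAt_const (1 : ℝ) t).sub
      (HasFDerivAt.fun_sum fun j _ => hasFDerivAt_apply j t), fun s => ?_⟩
    simp
  | succ j => exact ⟨_, hasFDerivAt_apply j t, fun s => rfl⟩

end Simplex

/-! ### The canonical connection and its exterior derivative -/

section Connection

variable {n p : ℕ}

theorem gInvDg_apply (i : Fin (p + 1)) (g : NBar n p) (v : Fin 1 → NBarLie n p) :
    gInvDg n p i g v =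
      starMulDeriv (nbarCoord g i) (extChartAt 𝓘(ℝ, NBarLie n p) g g) v := by
  rw [← gInvDg_inChart, DForm.inChart_self]

/-- Each `θ_i` is pulled back from the group factor, so it does not see the simplex directions; this
is what makes the `dt`-count work. -/
theorem starMulDeriv_comp_snd (g : NBar n p) (i : Fin (p + 1)) (A : (Fin p → ℝ) × NBarLie n p)
    (v : (Fin p → ℝ) × NBarLie n p) :
    starMulDeriv (fun z : (Fin p → ℝ) × NBarLie n p => nbarCoord g i z.2) A ![v] =
      starMulDeriv (nbarCoord g i) A.2 ![v.2] := by
  have h := (((contDiff_nbarCoord g i).differentiable (by simp) A.2).hasFDerivAt.comp A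
    (hasFDerivAt_snd (𝕜 := ℝ))).fderiv
  rw [starMulDeriv_apply, starMulDeriv_apply]
  exact congrArg (star (nbarCoord g i A.2) * ·) (DFunLike.congr_fun h v)

theorem contDiff_nbarCoord_snd (g : NBar n p) (i : Fin (p + 1)) :
    ContDiff ℝ ∞ fun z : (Fin p → ℝ) × NBarLie n p => nbarCoord g i z.2 :=
  (contDiff_nbarCoord g i).comp contDiff_snd

theorem canonicalConnection_apply (t : Fin p → ℝ) (g : NBar n p)
    (v : (Fin p → ℝ) × NBarLie n p) :
    canonicalConnection n p (t, g) ![v] =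
      ∑ i, barycentric t i • gInvDg n p i g ![v.2] := by
  rw [← DForm.inChart_self (simpModel n p) (canonicalConnection n p) (t, g),
    canonicalConnection_inChart, extChartAt_simp_apply]
  simp only [ContinuousAlternatingMap.sum_apply, ContinuousAlternatingMap.smul_apply,
    gInvDg_apply]
  exact Finset.sum_congr rfl fun i _ => congrArg _ (starMulDeriv_comp_snd g i _ v)

/-- The canonical connection in the chart around `g`. -/
noncomputable def connectionChart (g : NBar n p) (A : (Fin p → ℝ) × NBarLie n p) :
    ((Fin p → ℝ) × NBarLie n p) [⋀^Fin 1]→L[ℝ] Mat n :=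
  ∑ i, barycentric A.1 i •
    starMulDeriv (fun z : (Fin p → ℝ) × NBarLie n p => nbarCoord g i z.2) A

theorem differentiableAt_connectionChart (g : NBar n p) (A : (Fin p → ℝ) × NBarLie n p) :
    DifferentiableAt ℝ (connectionChart g) A := by
  have h1 : ∀ i, DifferentiableAt ℝ
      (fun B : (Fin p → ℝ) × NBarLie n p => barycentric B.1 i) A := fun i => by
    obtain ⟨L, hL, -⟩ := hasFDerivAt_barycentric A.1 i
    exact (hL.comp A hasFDerivAt_fst).differentiableAt
  have h2 : DifferentiableAt ℝ (fun B : (Fin p → ℝ) × NBarLie n p => ∑ i, barycentric B.1 i •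
      (ContinuousLinearMap.mul ℝ (Mat n) (star (nbarCoord g i B.2))).comp
        (fderiv ℝ (fun z : (Fin p → ℝ) × NBarLie n p => nbarCoord g i z.2) B)) A :=
    DifferentiableAt.fun_sum fun i _ => (h1 i).fun_smul
      ((contDiff_mul_star_comp_fderiv (contDiff_nbarCoord_snd g i)).differentiable (by simp) A)
  -- One-forms are identified isometrically with linear maps, where the product rule applies.
  have h3 : connectionChart g = fun B => ContinuousAlternatingMap.ofSubsingletonLIE (𝕜 := ℝ)
      (E := (Fin p → ℝ) × NBarLie n p) (F := Mat n) (0 : Fin 1) (∑ i, barycentric B.1 i •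
        (ContinuousLinearMap.mul ℝ (Mat n) (star (nbarCoord g i B.2))).comp
          (fderiv ℝ (fun z : (Fin p → ℝ) × NBarLie n p => nbarCoord g i z.2) B)) := by
    funext B
    simp only [map_sum, map_smul]
    rfl
  rw [h3]
  exact differentiableAt_ofSubsingletonLIE h2

theorem fderiv_connectionChart_apply (g : NBar n p) (A v w : (Fin p → ℝ) × NBarLie n p) :
    fderiv ℝ (fun B => connectionChart g B ![v]) A w =
      ∑ i, ((Fin.cons (-∑ j, w.1 j) w.1 : Fin (p + 1) → ℝ) i •
          starMulDeriv (nbarCoord g i) A.2 ![v.2] +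
        barycentric A.1 i • (star (nbarCoord g i A.2) * fderiv ℝ (fderiv ℝ
          fun z : (Fin p → ℝ) × NBarLie n p => nbarCoord g i z.2) A w v -
          starMulDeriv (nbarCoord g i) A.2 ![w.2] * starMulDeriv (nbarCoord g i) A.2 ![v.2])) := by
  choose L hL hLw using fun i => hasFDerivAt_barycentric A.1 i
  choose K hK hKw using fun i => hasFDerivAt_starMulDeriv_apply
    (contDiff_nbarCoord_snd g i) (fun y => star_nbarCoord_mul_self g i y.2) A v w
  have hb : ∀ i, HasFDerivAt (fun B : (Fin p → ℝ) × NBarLie n p => barycentric B.1 i)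
      ((L i).comp (ContinuousLinearMap.fst ℝ _ _)) A := fun i => (hL i).comp A hasFDerivAt_fst
  have h := HasFDerivAt.fun_sum (u := Finset.univ) fun i _ => (hb i).fun_smul (hK i)
  have h' : (fun B => connectionChart g B ![v]) = fun B =>
      ∑ i, barycentric B.1 i •
        starMulDeriv (fun z : (Fin p → ℝ) × NBarLie n p => nbarCoord g i z.2) B ![v] := by
    funext B
    simp only [connectionChart, ContinuousAlternatingMap.sum_apply,
      ContinuousAlternatingMap.smul_apply]
  rw [h', h.fderiv, sum_apply]
  refine Finset.sum_congr rfl fun i _ => ?_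
  have h2 := hKw i
  rw [starMulDeriv_comp_snd, starMulDeriv_comp_snd] at h2
  rw [← h2, ← hLw, ← starMulDeriv_comp_snd g i A v]
  exact add_comm _ _

/-- This is `∑ dt_i ∧ θ_i - ∑ t_i θ_i ∧ θ_i`; the `Fin.cons` entries are the values of `dt_i`, with
`dt₀ = -∑ dt_j`. -/
theorem extDeriv_connectionChart_apply (g : NBar n p) (A v w : (Fin p → ℝ) × NBarLie n p) :
    extDeriv (connectionChart g) A ![v, w] =
      ∑ i, ((Fin.cons (-∑ j, v.1 j) v.1 : Fin (p + 1) → ℝ) i •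
          starMulDeriv (nbarCoord g i) A.2 ![w.2] -
        (Fin.cons (-∑ j, w.1 j) w.1 : Fin (p + 1) → ℝ) i •
          starMulDeriv (nbarCoord g i) A.2 ![v.2] -
        barycentric A.1 i •
          (starMulDeriv (nbarCoord g i) A.2 ![v.2] * starMulDeriv (nbarCoord g i) A.2 ![w.2] -
          starMulDeriv (nbarCoord g i) A.2 ![w.2] * starMulDeriv (nbarCoord g i) A.2 ![v.2])) := by
  rw [extDeriv_apply (differentiableAt_connectionChart g A)]
  have e0 : (0 : Fin 2).removeNth ![v, w] = ![w] := by
    ext i : 1; fin_cases i; rfl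
  have e1 : (1 : Fin 2).removeNth ![v, w] = ![v] := by
    ext i : 1; fin_cases i; rfl
  rw [Fin.sum_univ_two, e0, e1]
  simp only [Matrix.cons_val_zero, Matrix.cons_val_one, fderiv_connectionChart_apply,
    Fin.val_zero, pow_zero, one_smul,
    Fin.val_one, pow_one, neg_smul, ← sub_eq_add_neg, ← Finset.sum_sub_distrib]
  refine Finset.sum_congr rfl fun i _ => ?_
  have hsymm : fderiv ℝ (fderiv ℝ fun z : (Fin p → ℝ) × NBarLie n p => nbarCoord g i z.2) A v w =
      fderiv ℝ (fderiv ℝ fun z : (Fin p → ℝ) × NBarLie n p => nbarCoord g i z.2) A w v :=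
    ((contDiff_nbarCoord_snd g i).contDiffAt.isSymmSndFDerivAt minSmoothness_two_le_infty).eq v w
  rw [hsymm]
  module

theorem canonicalConnection_d_apply {t : Fin p → ℝ} (ht : t ∈ interior (simplex p))
    (g : NBar n p) (v w : (Fin p → ℝ) × NBarLie n p) :
    SimpForm.d (canonicalConnection n) p (t, g) ![v, w] =
      ∑ i, ((Fin.cons (-∑ j, v.1 j) v.1 : Fin (p + 1) → ℝ) i • gInvDg n p i g ![w.2] -
        (Fin.cons (-∑ j, w.1 j) w.1 : Fin (p + 1) → ℝ) i • gInvDg n p i g ![v.2] -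
        barycentric t i • (gInvDg n p i g ![v.2] * gInvDg n p i g ![w.2] -
          gInvDg n p i g ![w.2] * gInvDg n p i g ![v.2])) := by
  -- The chart leaves `t` unchanged, so over an interior `t` the set is a neighbourhood and the
  -- derivative within it is the ordinary one.
  have hset : (extChartAt (simpModel n p) (t, g)).symm ⁻¹' (simplex p ×ˢ Set.univ) ∩
      Set.range (simpModel n p) ∈ nhds (extChartAt (simpModel n p) (t, g) (t, g)) := by
    rw [ModelWithCorners.range_eq_univ, Set.inter_univ]
    have : (extChartAt (simpModel n p) (t, g)).symm ⁻¹' (simplex p ×ˢ Set.univ) =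
        Prod.fst ⁻¹' simplex p := by
      ext B
      rw [Set.mem_preimage, extChartAt_simp_symm_apply]
      simp
    rw [this, extChartAt_simp_apply]
    exact continuous_fst.continuousAt.preimage_mem_nhds (mem_interior_iff_mem_nhds.1 ht)
  have hform : (canonicalConnection n p).inChart (simpModel n p) (t, g) = connectionChart g :=
    funext fun A => canonicalConnection_inChart (t, g) A
  unfold SimpForm.d
  rw [DForm.extDWithin_eq, extDerivWithin, fderivWithin_of_mem_nhds hset, hform,
    extChartAt_simp_apply]
  refine (extDeriv_connectionChart_apply g _ v w).trans ?_
  simp only [gInvDg_apply]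

end Connection

/-! ### The transgression form and its integrals over the simplices -/

section Transgression

variable {n p : ℕ}

theorem intervalIntegral_smul_add_sq_smul {V : Type*} [NormedAddCommGroup V] [NormedSpace ℝ V]
    [CompleteSpace V] (X Y : V) :
    ∫ s in (0 : ℝ)..1, (s • X + s ^ 2 • Y) = (1 / 2 : ℝ) • X + (1 / 3 : ℝ) • Y := by
  rw [intervalIntegral.integral_add (by apply Continuous.intervalIntegrable; fun_prop)
    (by apply Continuous.intervalIntegrable; fun_prop), intervalIntegral.integral_smul_const,
    intervalIntegral.integral_smul_const, integral_id, integral_pow]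
  norm_num

/-- Since `½ s + ½ s (s - 1) = ½ s²`, the path is `φ_s = s dθ + ½ s² [θ, θ]`, and `2 ∫ s = 1`, `2 ∫
½ s² = ⅓`. -/
theorem transgression_eq (P : Mat n →L[ℝ] Mat n →L[ℝ] ℂ) (θ : SimpForm n (Mat n) 1)
    (x : (Fin p → ℝ) × NBar n p) :
    transgression P θ p x = altWedge P (θ p x) (θ.d p x) +
      (1 / 3 : ℝ) • altWedge P (θ p x) (altWedge (bracketCLM n) (θ p x) (θ p x)) := by
  have h : ∀ s : ℝ, θ.wedge P (curvaturePath θ s) p x =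
      s • altWedge P (θ p x) (θ.d p x) + s ^ 2 •
        ((1 / 2 : ℝ) • altWedge P (θ p x) (altWedge (bracketCLM n) (θ p x) (θ p x))) := by
    intro s
    have h1 : curvaturePath θ s p x = s • θ.d p x +
        (s ^ 2 * (1 / 2)) • altWedge (bracketCLM n) (θ p x) (θ p x) := by
      change s • (θ.d p x + (1 / 2 : ℝ) • altWedge (bracketCLM n) (θ p x) (θ p x)) +
        (1 / 2 * s * (s - 1)) • altWedge (bracketCLM n) (θ p x) (θ p x) = _
      module
    change altWedge P (θ p x) (curvaturePath θ s p x) = _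
    rw [h1, altWedge_add_right, altWedge_smul_right, altWedge_smul_right, smul_smul]
  unfold transgression
  simp only [h]
  rw [intervalIntegral_smul_add_sq_smul]
  module

theorem altWedge_bracketCLM_self_apply {E : Type*} [NormedAddCommGroup E] [NormedSpace ℝ E]
    (α : E [⋀^Fin 1]→L[ℝ] Mat n) (v w : E) :
    altWedge (bracketCLM n) α α ![v, w] =
      (2 : ℝ) • (α ![v] * α ![w] - α ![w] * α ![v]) := by
  rw [altWedge_one_one_apply]
  change (α ![v] * α ![w] - α ![w] * α ![v]) - (α ![w] * α ![v] - α ![v] * α ![w]) = _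
  module

theorem chernTwoPol_eq (X Y : Mat n) : chernTwoPol n X Y =
    (1 / (2 * Real.pi * Complex.I)) ^ 2 * (1 / 2) *
      (X.trace * Y.trace - (X * Y).trace) := by
  rw [chernTwoPol_apply]
  simp only [chernPoly_two, Matrix.trace_add, add_mul, mul_add]
  rw [Matrix.trace_mul_comm Y X]
  ring

/-- The coefficient `2/3` is the `1/3` of the transgression times the `2` in `[θ, θ] = 2 θ ∧ θ`. -/
theorem transgression_apply (P : Mat n →L[ℝ] Mat n →L[ℝ] ℂ) (θ : SimpForm n (Mat n) 1)
    (x : (Fin p → ℝ) × NBar n p) (u v w : (Fin p → ℝ) × NBarLie n p) :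
    transgression P θ p x ![u, v, w] =
      P (θ p x ![u]) (θ.d p x ![v, w]) - P (θ p x ![v]) (θ.d p x ![u, w]) +
        P (θ p x ![w]) (θ.d p x ![u, v]) + (2 / 3 : ℝ) • (
          P (θ p x ![u]) (θ p x ![v] * θ p x ![w] - θ p x ![w] * θ p x ![v]) -
          P (θ p x ![v]) (θ p x ![u] * θ p x ![w] - θ p x ![w] * θ p x ![u]) +
          P (θ p x ![w]) (θ p x ![u] * θ p x ![v] - θ p x ![v] * θ p x ![u])) := by
  rw [transgression_eq, ContinuousAlternatingMap.add_apply, ContinuousAlternatingMap.smul_apply,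
    altWedge_one_two_apply, altWedge_one_two_apply]
  simp only [Matrix.cons_val_zero, Matrix.cons_val_one, Matrix.cons_val,
    altWedge_bracketCLM_self_apply, map_smul]
  module

/-- Reduces each component to evaluating the transgression form on the simplex directions followed
by group directions, at interior points, where the answer must not depend on `t`. -/
theorem chernSimonsTwo_eq_of_interior (q : Fin 4) (g : NBar n q) (c : NBarForm n q (3 - q))
    (h : ∀ t ∈ interior (simplex q), ∀ v : Fin (3 - q) → NBarLie n q,
      transgression (chernTwoPol n) (canonicalConnection n) q (t, g)
        (insertTuple (fun i : Fin q => ((Pi.single i 1, 0) : (Fin q → ℝ) × NBarLie n q))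
          fun i => (0, v i)) = c g v) :
    chernSimonsTwo n q g = MeasureTheory.volume.real (simplex q) • c g :=
  setIntegral_simplex_of_interior fun t ht => by
    ext v
    exact h t ht v

theorem gInvDg_apply_zero (i : Fin (p + 1)) (g : NBar n p) : gInvDg n p i g ![0] = 0 :=
  (gInvDg n p i g).map_coord_zero 0 rfl

theorem trace_mul_cycle_right (X Y Z : Mat n) : (X * (Y * Z)).trace = (Y * (Z * X)).trace := by
  rw [Matrix.trace_mul_comm, mul_assoc]

/-- The six signed products fall into two cyclic classes of three; cyclic permutations of three
letters are even, so each class contributes three equal terms. -/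
theorem trace_altWedge_mul_mul_apply {E : Type*} [NormedAddCommGroup E] [NormedSpace ℝ E]
    (α : E [⋀^Fin 1]→L[ℝ] Mat n) (u v w : E) :
    Matrix.trace (altWedge (ContinuousLinearMap.mul ℝ (Mat n))
      (altWedge (ContinuousLinearMap.mul ℝ (Mat n)) α α) α ![u, v, w]) =
    3 * ((α ![u] * (α ![v] * α ![w])).trace - (α ![u] * (α ![w] * α ![v])).trace) := by
  rw [altWedge_two_one_apply]
  simp only [altWedge_one_one_apply, Matrix.cons_val_zero, Matrix.cons_val_one, Matrix.cons_val,
    ContinuousLinearMap.mul_apply']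
  generalize α ![u] = a
  generalize α ![v] = b
  generalize α ![w] = c
  have e1 := trace_mul_cycle_right b a c
  have e2 := trace_mul_cycle_right c a b
  have e3 := trace_mul_cycle_right a b c
  have e4 := trace_mul_cycle_right a c b
  simp only [sub_mul, Matrix.trace_sub, Matrix.trace_add, mul_assoc]
  rw [← e3, ← e4, e1, e2]
  ring

theorem Tc03_apply (g : NBar n 0) (u v w : NBarLie n 0) : Tc03 n g ![u, v, w] =
    (1 / (2 * Real.pi * Complex.I)) ^ 2 * (1 / 2) *
      ((gInvDg n 0 0 g ![u] * (gInvDg n 0 0 g ![v] * gInvDg n 0 0 g ![w])).trace -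
        (gInvDg n 0 0 g ![u] * (gInvDg n 0 0 g ![w] * gInvDg n 0 0 g ![v])).trace) := by
  change (1 / (2 * Real.pi * Complex.I)) ^ 2 * ((1 / 6 : ℂ) * Matrix.trace
    (altWedge (ContinuousLinearMap.mul ℝ (Mat n)) (altWedge (ContinuousLinearMap.mul ℝ (Mat n))
      (gInvDg n 0 0 g) (gInvDg n 0 0 g)) (gInvDg n 0 0 g) ![u, v, w])) = _
  rw [trace_altWedge_mul_mul_apply]
  ring

/-- Here `dθ = -θ²` contributes `-1` and the bracket term `2/3`. Commutators are traceless, so only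
`-½ tr XY` in `P` matters; the three slots then give `3 · (-⅓) · (-½) = ½`. -/
theorem transgression_zero_apply {t : Fin 0 → ℝ} (ht : t ∈ interior (simplex 0)) (g : NBar n 0)
    (u v w : NBarLie n 0) :
    transgression (chernTwoPol n) (canonicalConnection n) 0 (t, g) ![(0, u), (0, v), (0, w)] =
      Tc03 n g ![u, v, w] := by
  have h1 : ∀ v : NBarLie n 0, canonicalConnection n 0 (t, g) ![(0, v)] = gInvDg n 0 0 g ![v] :=
    fun v => by
      rw [canonicalConnection_apply]
      simp [barycentric]
  have h2 : ∀ v w : NBarLie n 0, SimpForm.d (canonicalConnection n) 0 (t, g) ![(0, v), (0, w)] =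
      -(gInvDg n 0 0 g ![v] * gInvDg n 0 0 g ![w] -
        gInvDg n 0 0 g ![w] * gInvDg n 0 0 g ![v]) := fun v w => by
    rw [canonicalConnection_d_apply ht]
    simp [barycentric]
  rw [transgression_apply]
  simp only [h1, h2, Tc03_apply, chernTwoPol_eq, Complex.real_smul]
  generalize gInvDg n 0 0 g ![u] = a
  generalize gInvDg n 0 0 g ![v] = b
  generalize gInvDg n 0 0 g ![w] = c
  have e1 := trace_mul_cycle_right b a c
  have e2 := trace_mul_cycle_right c a b
  have e3 := trace_mul_cycle_right a b c
  have e4 := trace_mul_cycle_right a c b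
  simp only [mul_sub, mul_neg, Matrix.trace_sub, Matrix.trace_neg]
  -- All cubic traces become `tr abc` or `tr acb`, while the commuted pairs make the traces of
  -- commutators cancel.
  rw [← e3, ← e4, e1, e2, Matrix.trace_mul_comm c b, Matrix.trace_mul_comm c a,
    Matrix.trace_mul_comm b a]
  push_cast
  ring

theorem Tc12_apply (g : NBar n 1) (v w : NBarLie n 1) : Tc12 n g ![v, w] =
    (1 / (2 * Real.pi * Complex.I)) ^ 2 * (1 / 2) *
      ((gInvDg n 1 0 g ![v] * gInvDg n 1 1 g ![w]).trace -
        (gInvDg n 1 0 g ![w] * gInvDg n 1 1 g ![v]).trace -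
        ((gInvDg n 1 0 g ![v]).trace * (gInvDg n 1 1 g ![w]).trace -
          (gInvDg n 1 0 g ![w]).trace * (gInvDg n 1 1 g ![v]).trace)) := by
  change (1 / (2 * Real.pi * Complex.I)) ^ 2 *
    ((1 / 2 : ℂ) * Matrix.trace (altWedge (ContinuousLinearMap.mul ℝ (Mat n))
        (gInvDg n 1 0 g) (gInvDg n 1 1 g) ![v, w]) -
      (1 / 2 : ℂ) * altWedge (ContinuousLinearMap.mul ℝ ℂ)
        (DForm.mapVal (traceCLM n) (gInvDg n 1 0) g)
        (DForm.mapVal (traceCLM n) (gInvDg n 1 1) g) ![v, w]) = _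
  rw [altWedge_one_one_apply, altWedge_one_one_apply, Matrix.trace_sub]
  simp only [Matrix.cons_val_zero, Matrix.cons_val_one, ContinuousLinearMap.mul_apply']
  change (1 / (2 * Real.pi * Complex.I)) ^ 2 *
    ((1 / 2 : ℂ) * _ - (1 / 2 : ℂ) * ((gInvDg n 1 0 g ![v]).trace * (gInvDg n 1 1 g ![w]).trace -
          (gInvDg n 1 0 g ![w]).trace * (gInvDg n 1 1 g ![v]).trace)) = _
  ring

/-- The connection vanishes on `∂/∂t₁`, so the cubic term and one `dθ` term drop out. What is left
pairs `(1 - t) θ₀ + t θ₁` with `θ₁ - θ₀`, and the symmetry of `P` makes the dependence on `t`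
cancel. -/
theorem transgression_one_apply {t : Fin 1 → ℝ} (ht : t ∈ interior (simplex 1)) (g : NBar n 1)
    (v w : NBarLie n 1) :
    transgression (chernTwoPol n) (canonicalConnection n) 1 (t, g)
        ![(Pi.single 0 1, 0), (0, v), (0, w)] =
      Tc12 n g ![v, w] := by
  have h0 : canonicalConnection n 1 (t, g) ![(Pi.single 0 1, 0)] = 0 := by
    rw [canonicalConnection_apply]
    simp [gInvDg_apply_zero]
  have h1 : ∀ v : NBarLie n 1, canonicalConnection n 1 (t, g) ![(0, v)] =
      (1 - t 0) • gInvDg n 1 0 g ![v] + t 0 • gInvDg n 1 1 g ![v] := fun v => by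
    rw [canonicalConnection_apply]
    simp [barycentric]
  have h2 : ∀ w : NBarLie n 1,
      SimpForm.d (canonicalConnection n) 1 (t, g) ![(Pi.single 0 1, 0), (0, w)] =
        gInvDg n 1 1 g ![w] - gInvDg n 1 0 g ![w] := fun w => by
    rw [canonicalConnection_d_apply ht]
    simp [gInvDg_apply_zero, neg_add_eq_sub]
  rw [transgression_apply]
  simp only [h0, h1, h2, Tc12_apply, map_zero, zero_apply, zero_mul, mul_zero, sub_self,
    smul_zero, add_zero, zero_sub, chernTwoPol_eq]
  generalize gInvDg n 1 0 g ![v] = a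
  generalize gInvDg n 1 0 g ![w] = b
  generalize gInvDg n 1 1 g ![v] = c
  generalize gInvDg n 1 1 g ![w] = d
  simp only [mul_sub, add_mul, smul_mul_assoc, Matrix.trace_sub, Matrix.trace_add,
    Matrix.trace_smul, Complex.real_smul, Complex.ofReal_sub, Complex.ofReal_one]
  rw [Matrix.trace_mul_comm b a, Matrix.trace_mul_comm d a, Matrix.trace_mul_comm d c,
    Matrix.trace_mul_comm b c]
  ring

theorem chernSimonsTwo_zero : chernSimonsTwo n 0 = Tc03 n := by
  funext g
  refine (chernSimonsTwo_eq_of_interior 0 g (Tc03 n) fun t ht v => ?_).trans ?_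
  swap
  · exact (congrArg (· • Tc03 n g) volume_simplex_zero).trans (one_smul ℝ _)
  have hv : insertTuple (fun i : Fin 0 => ((Pi.single i 1, 0) : (Fin 0 → ℝ) × NBarLie n 0))
      (fun i : Fin 3 => (0, v i)) = ![(0, v (0 : Fin 3)), (0, v (1 : Fin 3)), (0, v (2 : Fin 3))] := by
    ext i : 1
    fin_cases i <;> rfl
  have hv' : ![v (0 : Fin 3), v (1 : Fin 3), v (2 : Fin 3)] = v := by
    ext i : 1
    fin_cases i <;> rfl
  refine (congrArg (transgression (chernTwoPol n) (canonicalConnection n) 0 (t, g)) hv).trans ?_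
  exact (transgression_zero_apply ht g _ _ _).trans (congrArg (Tc03 n g) hv')

theorem chernSimonsTwo_one : chernSimonsTwo n 1 = Tc12 n := by
  funext g
  refine (chernSimonsTwo_eq_of_interior 1 g (Tc12 n) fun t ht v => ?_).trans ?_
  swap
  · exact (congrArg (· • Tc12 n g) volume_simplex_one).trans (one_smul ℝ _)
  have hv : insertTuple (fun i : Fin 1 => ((Pi.single i 1, 0) : (Fin 1 → ℝ) × NBarLie n 1))
      (fun i : Fin 2 => (0, v i)) =
        ![(Pi.single 0 1, 0), (0, v (0 : Fin 2)), (0, v (1 : Fin 2))] := by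
    ext i : 1
    fin_cases i <;> rfl
  have hv' : ![v (0 : Fin 2), v (1 : Fin 2)] = v := by
    ext i : 1
    fin_cases i <;> rfl
  refine (congrArg (transgression (chernTwoPol n) (canonicalConnection n) 1 (t, g)) hv).trans ?_
  exact (transgression_one_apply ht g _ _).trans (congrArg (Tc12 n g) hv')

theorem chernSimonsTwo_two : chernSimonsTwo n 2 = 0 := by
  funext g
  refine (chernSimonsTwo_eq_of_interior 2 g 0 fun t ht v => ?_).trans (smul_zero _)
  have hv : insertTuple (fun i : Fin 2 => ((Pi.single i 1, 0) : (Fin 2 → ℝ) × NBarLie n 2))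
      (fun i : Fin 1 => (0, v i)) =
        ![(Pi.single 0 1, 0), (Pi.single 1 1, 0), (0, v (0 : Fin 1))] := by
    ext i : 1
    fin_cases i <;> rfl
  refine (congrArg (transgression (chernTwoPol n) (canonicalConnection n) 2 (t, g)) hv).trans ?_
  rw [transgression_apply]
  -- Two arguments are simplex directions: either one of them enters the connection, or both enter
  -- `dθ`, and each such term is zero. The volume of the simplex is irrelevant.
  simp [canonicalConnection_apply, canonicalConnection_d_apply (p := 2) ht, gInvDg_apply_zero]

theorem chernSimonsTwo_three : chernSimonsTwo n 3 = 0 := by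
  funext g
  refine (chernSimonsTwo_eq_of_interior 3 g 0 fun t ht v => ?_).trans (smul_zero _)
  have hv : insertTuple (fun i : Fin 3 => ((Pi.single i 1, 0) : (Fin 3 → ℝ) × NBarLie n 3))
      (fun i : Fin 0 => (0, v i)) =
        ![(Pi.single 0 1, 0), (Pi.single 1 1, 0), (Pi.single 2 1, 0)] := by
    ext i : 1
    fin_cases i <;> rfl
  refine (congrArg (transgression (chernTwoPol n) (canonicalConnection n) 3 (t, g)) hv).trans ?_
  rw [transgression_apply]
  simp [canonicalConnection_apply, canonicalConnection_d_apply (p := 3) ht, gInvDg_apply_zero]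

end Transgression

/-! ### Operations preserving smoothness of forms -/

section Smooth

variable {E F F' F'' H M : Type*}
  [NormedAddCommGroup E] [NormedSpace ℝ E]
  [NormedAddCommGroup F] [NormedSpace ℝ F] [NormedAddCommGroup F'] [NormedSpace ℝ F']
  [NormedAddCommGroup F''] [NormedSpace ℝ F'']
  [TopologicalSpace H] [TopologicalSpace M] [ChartedSpace H M]
  {I : ModelWithCorners ℝ E H}

theorem DForm.IsSmooth.wedge (B : F →L[ℝ] F' →L[ℝ] F'') {k l : ℕ} {α : DForm M E F k}
    {β : DForm M E F' l} (hα : α.IsSmooth I) (hβ : β.IsSmooth I) : (α.wedge B β).IsSmooth I :=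
  fun x => (contDiffOn_altWedge B (hα x) (hβ x)).congr fun y _ => DForm.inChart_wedge I B α β x y

theorem DForm.IsSmooth.mapVal (L : F →L[ℝ] F') {k : ℕ} {α : DForm M E F k}
    (hα : α.IsSmooth I) : (DForm.mapVal L α).IsSmooth I := fun x => by
  have h := (ContinuousLinearMap.compContinuousAlternatingMapCLM (𝕜 := ℝ) (E := E) (F := F)
    (G := F') (ι := Fin k) L).contDiff (n := ∞)
  exact h.comp_contDiffOn (hα x)

theorem DForm.IsSmooth.sub {k : ℕ} {α β : DForm M E F k}
    (hα : α.IsSmooth I) (hβ : β.IsSmooth I) : (α - β).IsSmooth I := fun x =>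
  (ContDiffOn.sub (hα x) (hβ x)).congr fun y _ => by
    ext v
    rfl

end Smooth

/-! ### Smoothness of the explicit forms and closedness of `tr θ³` -/

section Explicit

variable {n p : ℕ}

theorem isSmooth_gInvDg (i : Fin (p + 1)) : (gInvDg n p i).IsSmooth 𝓘(ℝ, NBarLie n p) := fun g =>
  (contDiff_starMulDeriv (contDiff_nbarCoord g i)).contDiffOn.congr fun A _ =>
    gInvDg_inChart i g A

/-- Moving the complex constant into the real-linear map lets the chart expression and smoothness
come from the lemmas on `DForm.mapVal`; `Tc12_eq_sub` has the same purpose. -/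
theorem Tc03_eq_mapVal : Tc03 n = DForm.mapVal
    (((1 / (2 * Real.pi * Complex.I)) ^ 2 * (1 / 6) : ℂ) • traceCLM n)
      (((gInvDg n 0 0).wedge (ContinuousLinearMap.mul ℝ (Mat n)) (gInvDg n 0 0)).wedge
        (ContinuousLinearMap.mul ℝ (Mat n)) (gInvDg n 0 0)) := by
  funext g
  ext v
  exact (mul_assoc _ _ _).symm

theorem isSmooth_Tc03 : (Tc03 n).IsSmooth 𝓘(ℝ, NBarLie n 0) := by
  rw [Tc03_eq_mapVal]
  exact (((isSmooth_gInvDg 0).wedge _ (isSmooth_gInvDg 0)).wedge _ (isSmooth_gInvDg 0)).mapVal _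

theorem Tc12_eq_sub : Tc12 n =
    DForm.mapVal (((1 / (2 * Real.pi * Complex.I)) ^ 2 * (1 / 2) : ℂ) • traceCLM n)
        ((gInvDg n 1 0).wedge (ContinuousLinearMap.mul ℝ (Mat n)) (gInvDg n 1 1)) -
      DForm.mapVal (((1 / (2 * Real.pi * Complex.I)) ^ 2 * (1 / 2) : ℂ) •
        ContinuousLinearMap.id ℝ ℂ) ((DForm.mapVal (traceCLM n) (gInvDg n 1 0)).wedge
        (ContinuousLinearMap.mul ℝ ℂ) (DForm.mapVal (traceCLM n) (gInvDg n 1 1))) := by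
  funext g
  ext v
  refine (mul_sub _ _ _).trans ?_
  exact congrArg₂ (· - ·) (mul_assoc _ _ _).symm (mul_assoc _ _ _).symm

theorem isSmooth_Tc12 : (Tc12 n).IsSmooth 𝓘(ℝ, NBarLie n 1) := by
  rw [Tc12_eq_sub]
  exact (((isSmooth_gInvDg 0).wedge _ (isSmooth_gInvDg 1)).mapVal _).sub
    ((((isSmooth_gInvDg 0).mapVal _).wedge _ ((isSmooth_gInvDg 1).mapVal _)).mapVal _)

/-- The derivative of `tr (a b c) - tr (a c b)`, where `a`, `b`, `c` have derivatives
`a'`, `b'`, `c'`. -/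
def traceCubeDeriv (a b c a' b' c' : Mat n) : ℂ :=
  (a' * (b * c) + a * (b' * c + b * c')).trace - (a' * (c * b) + a * (c' * b + c * b')).trace

/-- The algebra behind `d tr θ³ = 0`, with `a_i = θ(v_i)` and `s_ij = u* d²u(v_i, v_j)`, so that
`a_j` has derivative `s_ij - a_i a_j` along `v_i`. By symmetry each `s_ij` comes from both
directions with opposite signs; the quartic terms cancel because a rotation of four letters is odd.
-/
theorem alternating_sum_traceCubeDeriv (a₀ a₁ a₂ a₃ s₀₁ s₀₂ s₀₃ s₁₂ s₁₃ s₂₃ : Mat n) :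
    traceCubeDeriv a₁ a₂ a₃ (s₀₁ - a₀ * a₁) (s₀₂ - a₀ * a₂) (s₀₃ - a₀ * a₃) -
    traceCubeDeriv a₀ a₂ a₃ (s₀₁ - a₁ * a₀) (s₁₂ - a₁ * a₂) (s₁₃ - a₁ * a₃) +
    traceCubeDeriv a₀ a₁ a₃ (s₀₂ - a₂ * a₀) (s₁₂ - a₂ * a₁) (s₂₃ - a₂ * a₃) -
    traceCubeDeriv a₀ a₁ a₂ (s₀₃ - a₃ * a₀) (s₁₃ - a₃ * a₁) (s₂₃ - a₃ * a₂) = 0 := by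
  have c1 : ∀ s x y : Mat n, (x * (s * y)).trace = (s * (y * x)).trace := fun s x y =>
    trace_mul_cycle_right x s y
  have c2 : ∀ s x y : Mat n, (x * (y * s)).trace = (s * (x * y)).trace := fun s x y =>
    (trace_mul_cycle_right s x y).symm
  have d1 : ∀ x y z : Mat n, (x * (a₀ * (y * z))).trace = (a₀ * (y * (z * x))).trace :=
    fun x y z => by rw [c1, mul_assoc]
  have d2 : ∀ x y z : Mat n, (x * (y * (a₀ * z))).trace = (a₀ * (z * (x * y))).trace :=
    fun x y z => by rw [← mul_assoc x y, c1]
  -- Every trace is rotated so that the `s` factor, or else `a₀`, comes first. No rule for `s₀₁` is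
  -- needed, as it only ever replaces the leading factor.
  simp only [traceCubeDeriv, mul_add, mul_sub, sub_mul, Matrix.trace_add, Matrix.trace_sub,
    mul_assoc, d1, d2, c1 s₀₂, c2 s₀₂, c1 s₀₃, c2 s₀₃, c1 s₁₂, c2 s₁₂,
    c1 s₁₃, c2 s₁₃, c1 s₂₃, c2 s₂₃]
  ring

theorem fderiv_trace_cube_apply {E : Type*} [NormedAddCommGroup E] [NormedSpace ℝ E]
    {a b c : E → Mat n} {a' b' c' : E →L[ℝ] Mat n} {y : E} (ha : HasFDerivAt a a' y)
    (hb : HasFDerivAt b b' y) (hc : HasFDerivAt c c' y) (k : ℂ) (w : E) :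
    fderiv ℝ (fun z => k * ((a z * (b z * c z)).trace - (a z * (c z * b z)).trace)) y w =
      k * traceCubeDeriv (a y) (b y) (c y) (a' w) (b' w) (c' w) := by
  have h1 := (traceCLM n).hasFDerivAt.comp y (ha.mul' (hb.mul' hc))
  have h2 := (traceCLM n).hasFDerivAt.comp y (ha.mul' (hc.mul' hb))
  have h3 := (h1.sub h2).const_mul k
  refine (DFunLike.congr_fun h3.fderiv w).trans ?_
  unfold traceCubeDeriv
  rw [add_comm (a' w * (b y * c y)), add_comm (a' w * (c y * b y)), add_comm (b' w * c y),
    add_comm (c' w * b y)]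
  rfl

theorem Tc03_inChart_apply (g : NBar n 0) (A u v w : NBarLie n 0) :
    (Tc03 n).inChart 𝓘(ℝ, NBarLie n 0) g A ![u, v, w] =
      (1 / (2 * Real.pi * Complex.I)) ^ 2 * (1 / 2) *
      ((starMulDeriv (nbarCoord g 0) A ![u] * (starMulDeriv (nbarCoord g 0) A ![v] *
          starMulDeriv (nbarCoord g 0) A ![w])).trace -
        (starMulDeriv (nbarCoord g 0) A ![u] * (starMulDeriv (nbarCoord g 0) A ![w] *
          starMulDeriv (nbarCoord g 0) A ![v])).trace) := by
  rw [Tc03_eq_mapVal, DForm.inChart_mapVal, DForm.inChart_wedge, DForm.inChart_wedge,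
    gInvDg_inChart]
  refine (congrArg ((1 / (2 * Real.pi * Complex.I)) ^ 2 * (1 / 6) * ·)
    (trace_altWedge_mul_mul_apply (starMulDeriv (nbarCoord g 0) A) u v w)).trans ?_
  ring

theorem fderiv_Tc03_inChart_apply (g : NBar n 0) (A x u v w : NBarLie n 0) :
    fderiv ℝ (fun B => (Tc03 n).inChart 𝓘(ℝ, NBarLie n 0) g B ![u, v, w]) A x =
      (1 / (2 * Real.pi * Complex.I)) ^ 2 * (1 / 2) *
      traceCubeDeriv (starMulDeriv (nbarCoord g 0) A ![u]) (starMulDeriv (nbarCoord g 0) A ![v])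
        (starMulDeriv (nbarCoord g 0) A ![w])
        (star (nbarCoord g 0 A) * fderiv ℝ (fderiv ℝ (nbarCoord g 0)) A x u -
          starMulDeriv (nbarCoord g 0) A ![x] * starMulDeriv (nbarCoord g 0) A ![u])
        (star (nbarCoord g 0 A) * fderiv ℝ (fderiv ℝ (nbarCoord g 0)) A x v -
          starMulDeriv (nbarCoord g 0) A ![x] * starMulDeriv (nbarCoord g 0) A ![v])
        (star (nbarCoord g 0 A) * fderiv ℝ (fderiv ℝ (nbarCoord g 0)) A x w -
          starMulDeriv (nbarCoord g 0) A ![x] * starMulDeriv (nbarCoord g 0) A ![w]) := by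
  choose K hK hKx using fun v => hasFDerivAt_starMulDeriv_apply
    (contDiff_nbarCoord g 0) (star_nbarCoord_mul_self g 0) A v x
  simp only [Tc03_inChart_apply, ← hKx]
  exact fderiv_trace_cube_apply (hK u) (hK v) (hK w) _ x

theorem extD_Tc03 : (Tc03 n).extD 𝓘(ℝ, NBarLie n 0) = 0 := by
  funext g
  rw [DForm.extD_eq]
  have hd : DifferentiableAt ℝ ((Tc03 n).inChart 𝓘(ℝ, NBarLie n 0) g)
      (extChartAt 𝓘(ℝ, NBarLie n 0) g g) := by
    have h := isSmooth_Tc03 (n := n) g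
    exact (h.differentiableOn (by simp) _ (mem_extChartAt_target g)).differentiableAt
      (extChartAt_target_mem_nhds g)
  generalize extChartAt 𝓘(ℝ, NBarLie n 0) g g = A at hd
  ext v
  rw [extDeriv_apply hd]
  have r0 : (0 : Fin 4).removeNth v = ![v 1, v 2, v 3] := by ext j : 1; fin_cases j <;> rfl
  have r1 : (1 : Fin 4).removeNth v = ![v 0, v 2, v 3] := by ext j : 1; fin_cases j <;> rfl
  have r2 : (2 : Fin 4).removeNth v = ![v 0, v 1, v 3] := by ext j : 1; fin_cases j <;> rfl
  have r3 : (3 : Fin 4).removeNth v = ![v 0, v 1, v 2] := by ext j : 1; fin_cases j <;> rfl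
  have hsymm : ∀ x y, fderiv ℝ (fderiv ℝ (nbarCoord g 0)) A x y =
      fderiv ℝ (fderiv ℝ (nbarCoord g 0)) A y x :=
    ((contDiff_nbarCoord g 0).contDiffAt.isSymmSndFDerivAt minSmoothness_two_le_infty).eq
  have h := alternating_sum_traceCubeDeriv (starMulDeriv (nbarCoord g 0) A ![v 0])
    (starMulDeriv (nbarCoord g 0) A ![v 1]) (starMulDeriv (nbarCoord g 0) A ![v 2])
    (starMulDeriv (nbarCoord g 0) A ![v 3])
    (star (nbarCoord g 0 A) * fderiv ℝ (fderiv ℝ (nbarCoord g 0)) A (v 0) (v 1))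
    (star (nbarCoord g 0 A) * fderiv ℝ (fderiv ℝ (nbarCoord g 0)) A (v 0) (v 2))
    (star (nbarCoord g 0 A) * fderiv ℝ (fderiv ℝ (nbarCoord g 0)) A (v 0) (v 3))
    (star (nbarCoord g 0 A) * fderiv ℝ (fderiv ℝ (nbarCoord g 0)) A (v 1) (v 2))
    (star (nbarCoord g 0 A) * fderiv ℝ (fderiv ℝ (nbarCoord g 0)) A (v 1) (v 3))
    (star (nbarCoord g 0 A) * fderiv ℝ (fderiv ℝ (nbarCoord g 0)) A (v 2) (v 3))
  rw [Fin.sum_univ_four, r0, r1, r2, r3]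
  simp only [fderiv_Tc03_inChart_apply]
  -- Second derivatives are put in increasing order of indices, to match the single `s_ij` with `i <
  -- j` of the algebraic identity.
  rw [hsymm (v 1) (v 0), hsymm (v 2) (v 0), hsymm (v 2) (v 1), hsymm (v 3) (v 0),
    hsymm (v 3) (v 1), hsymm (v 3) (v 2)]
  have e : ∀ k x₀ x₁ x₂ x₃ : ℂ, x₀ - x₁ + x₂ - x₃ = 0 →
      (-1 : ℤ) ^ 0 • (k * x₀) + (-1 : ℤ) ^ 1 • (k * x₁) + (-1 : ℤ) ^ 2 • (k * x₂) +
        (-1 : ℤ) ^ 3 • (k * x₃) = 0 := fun k x₀ x₁ x₂ x₃ hx => by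
    simp only [zsmul_eq_mul]
    push_cast
    linear_combination k * hx
  exact e _ _ _ _ _ h

end Explicit

theorem mainTheorem7 (n : ℕ) :
    chernSimonsTwo n = Pi.single (0 : Fin 4) (Tc03 n) + Pi.single (1 : Fin 4) (Tc12 n) ∧
      (Tc03 n).IsSmooth 𝓘(ℝ, NBarLie n 0) ∧
      (Tc12 n).IsSmooth 𝓘(ℝ, NBarLie n 1) ∧
      verticalD (Tc03 n) = 0 := by
  refine ⟨?_, isSmooth_Tc03, isSmooth_Tc12, ?_⟩
  -- At each index the `Pi.single` terms reduce by computation, so only an addition of zero remains.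
  · funext p
    fin_cases p
    · exact (chernSimonsTwo_zero (n := n)).trans (add_zero _).symm
    · exact (chernSimonsTwo_one (n := n)).trans (zero_add _).symm
    · exact (chernSimonsTwo_two (n := n)).trans (add_zero _).symm
    · exact (chernSimonsTwo_three (n := n)).trans (add_zero _).symm
  · exact (congrArg ((-1 : ℝ) ^ 0 • ·) extD_Tc03).trans (smul_zero _)
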